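/- Let $\mathcal H$ be a finite-dimensional complex Hilbert space, and for each $n\ge 1$ let $\mathcal M_n$ be a convex and closed set of density operators on $\mathcal H^{\otimes n}$ that is closed under permutations of the tensor factors: if $\sigma\in\mathcal M_n$ and $\pi\in S_n$, then $P_\pi\sigma P_\pi^\dagger\in\mathcal M_n$, where $P_\pi$ is the unitary that permutes the $n$ tensor factors according to $\pi$. For density operators $\rho,\sigma$ let $$D(\rho\|\sigma)=\begin{cases}\operatorname{Tr}\rho(\log\rho-\log\sigma)&\text{if }\operatorname{supp}\rho\subseteq\operatorname{supp}\sigma,\\+\infty&\text{otherwise,}\end{cases}\qquad D^{\mathrm{ALL}}(\rho\|\sigma)=\sup_{(E_x)_x}\sum_x \operatorname{Tr}(\rho E_x)\log\frac{\operatorname{Tr}(\rho E_x)}{\operatorname{Tr}(\sigma E_x)},$$ where the supremum is over all POVMs with finitely many outcomes (finite families of positive semi-definite operators with $\sum_xE_x=\mathbb 1$), with $0\log(0/q)=0$ and $p\log(p/0)=+\infty$ for $p>0$. Let $\rho$ be a density operator on $\mathcal H$. Then for every $n\ge1$ with $\mathcal M_n\neq\emptyset$ the minima $$a_n=\min_{\sigma\in\mathcal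 M_n}D^{\mathrm{ALL}}(\rho^{\otimes n}\|\sigma)\quad\text{and}\quad b_n=\min_{\sigma\in\mathcal M_n}D(\rho^{\otimes n}\|\sigma)$$ are attained (in $[0,+\infty]$; put $a_n=b_n=+\infty$ if $\mathcal M_n=\emptyset$), and $$\lim_{n\to\infty}\frac1n\,\min_{\sigma\in\mathcal M_n}D^{\mathrm{ALL}}(\rho^{\otimes n}\|\sigma)=D^\infty_{\mathcal M}(\rho):=\lim_{n\to\infty}\frac1n\,\min_{\sigma\in\mathcal M_n}D(\rho^{\otimes n}\|\sigma)$$ in the sense that either limit exists in $[0,+\infty]$ if and only if the other one does, and then they are equal. Whether or not the limits exist, $\liminf_n a_n/n=\liminf_n b_n/n$ and $\limsup_n a_n/n=\limsup_n b_n/n$. -/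

import Mathlib

open Filter Topology
open scoped ComplexOrder

noncomputable section

namespace QRes

/-- Density matrices (quantum states) on the Hilbert space `ℂ^κ`. -/
def densityMatrices (κ : Type*) [Fintype κ] : Set (Matrix κ κ ℂ) :=
  {ρ | ρ.PosSemidef ∧ ρ.trace = 1}

/-- The support of a Hermitian matrix, i.e. its range (the orthogonal complement of its kernel). -/
def supp {κ : Type*} [Fintype κ] (X : Matrix κ κ ℂ) : Submodule ℂ (κ → ℂ) :=
  LinearMap.range X.mulVecLin

open Classical in
/-- Umegaki relative entropy `D(ρ‖σ)`, with values in the extended reals. The functional calculus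
is applied to `Real.log`, for which `Real.log 0 = 0`: logarithms are taken on the support. -/
def relEntropy {κ : Type*} [Fintype κ] [DecidableEq κ] (ρ σ : Matrix κ κ ℂ) : EReal :=
  if supp ρ ≤ supp σ then
    (((ρ * (cfc Real.log ρ - cfc Real.log σ)).trace.re : ℝ) : EReal)
  else ⊤

/-- A POVM with `k` outcomes on `ℂ^κ`. -/
structure IsPOVM {κ : Type*} [Fintype κ] [DecidableEq κ] {k : ℕ}
    (E : Fin k → Matrix κ κ ℂ) : Prop where
  posSemidef : ∀ x, (E x).PosSemidef
  sum_eq_one : ∑ x, E x = 1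

open Classical in
/-- The summand `p log (p / q)` of the classical Kullback-Leibler divergence, for `p, q ≥ 0`,
with the conventions `0 log (0 / q) = 0` and `p log (p / 0) = +∞` for `p > 0`. -/
def klTerm (p q : ℝ) : EReal :=
  if p = 0 then 0 else if q = 0 then ⊤ else ((p * Real.log (p / q) : ℝ) : EReal)

/-- The relative entropy `D^ALL(ρ‖σ)` measured by all POVMs with finitely many outcomes. -/
def measuredRelEntropy {κ : Type*} [Fintype κ] [DecidableEq κ] (ρ σ : Matrix κ κ ℂ) : EReal :=
  ⨆ (k : ℕ) (E : Fin k → Matrix κ κ ℂ) (_ : IsPOVM E),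
    ∑ x, klTerm (ρ * E x).trace.re (σ * E x).trace.re

/-- The tensor power `ρ^{⊗ n}`, acting on `(ℂ^ι)^{⊗ n} = ℂ^(Fin n → ι)`. -/
def tensorPow {ι : Type*} (ρ : Matrix ι ι ℂ) (n : ℕ) : Matrix (Fin n → ι) (Fin n → ι) ℂ :=
  Matrix.of fun i j => ∏ l, ρ (i l) (j l)

/-- The unitary `P_π` permuting the `n` tensor factors: it maps the basis vector
`e_{j 0} ⊗ ⋯ ⊗ e_{j (n-1)}` to the basis vector with index `j ∘ π⁻¹`. -/
def permUnitary {ι : Type*} [DecidableEq ι] {n : ℕ} (π : Equiv.Perm (Fin n)) :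
    Matrix (Fin n → ι) (Fin n → ι) ℂ :=
  Matrix.of fun i j => if i = j ∘ π.symm then 1 else 0

/-- Each set of free states `M n`, `n ≥ 1`, is a convex and closed set of density matrices. -/
structure ConvexClosedStates {ι : Type*} [Fintype ι]
    (M : (n : ℕ) → Set (Matrix (Fin n → ι) (Fin n → ι) ℂ)) : Prop where
  subset : ∀ n, 1 ≤ n → M n ⊆ densityMatrices (Fin n → ι)
  convex : ∀ n, 1 ≤ n → Convex ℝ (M n)
  closed : ∀ n, 1 ≤ n → IsClosed (M n)

/-- Each set of free states `M n`, `n ≥ 1`, is closed under permutations of the tensor factors. -/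
def PermutationClosed {ι : Type*} [Fintype ι] [DecidableEq ι]
    (M : (n : ℕ) → Set (Matrix (Fin n → ι) (Fin n → ι) ℂ)) : Prop :=
  ∀ n, 1 ≤ n → ∀ σ ∈ M n, ∀ π : Equiv.Perm (Fin n),
    permUnitary π * σ * (permUnitary π).conjTranspose ∈ M n

/-- The relative entropy of resource `D_S(ρ)`, the minimum of `D(ρ‖σ)` over `σ ∈ S`. -/
def relEntropyOfResource {κ : Type*} [Fintype κ] [DecidableEq κ]
    (S : Set (Matrix κ κ ℂ)) (ρ : Matrix κ κ ℂ) : EReal :=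
  ⨅ σ ∈ S, relEntropy ρ σ

/-- The measured relative entropy of resource, the minimum of `D^ALL(ρ‖σ)` over `σ ∈ S`. -/
def measuredRelEntropyOfResource {κ : Type*} [Fintype κ] [DecidableEq κ]
    (S : Set (Matrix κ κ ℂ)) (ρ : Matrix κ κ ℂ) : EReal :=
  ⨅ σ ∈ S, measuredRelEntropy ρ σ

/-- The sequence `(1 / n) D_{M n}(ρ^{⊗ n})`, whose limit is the regularised relative entropy of
resource. -/
def relEntropyRate {ι : Type*} [Fintype ι] [DecidableEq ι]
    (M : (n : ℕ) → Set (Matrix (Fin n → ι) (Fin n → ι) ℂ)) (ρ : Matrix ι ι ℂ) (n : ℕ) : EReal :=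
  ((1 / (n : ℝ) : ℝ) : EReal) * relEntropyOfResource (M n) (tensorPow ρ n)

/-- The sequence `(1 / n) min_{σ ∈ M n} D^ALL(ρ^{⊗ n}‖σ)`. -/
def measuredRelEntropyRate {ι : Type*} [Fintype ι] [DecidableEq ι]
    (M : (n : ℕ) → Set (Matrix (Fin n → ι) (Fin n → ι) ℂ)) (ρ : Matrix ι ι ℂ) (n : ℕ) : EReal :=
  ((1 / (n : ℝ) : ℝ) : EReal) * measuredRelEntropyOfResource (M n) (tensorPow ρ n)

/-- `D_M^∞(ρ)` exists, as a limit in the extended reals, and is equal to `L`. -/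
def HasRegularisedRelEntropy {ι : Type*} [Fintype ι] [DecidableEq ι]
    (M : (n : ℕ) → Set (Matrix (Fin n → ι) (Fin n → ι) ℂ)) (ρ : Matrix ι ι ℂ) (L : EReal) : Prop :=
  Tendsto (relEntropyRate M ρ) atTop (𝓝 L)

end QRes

end

/-! With d the dimension of the space, everything rests on a_n ≤ b_n ≤ a_n + log(2(n+1)^(d²)) for n
≥ 1. Divided by n, the correction tends to 0, so the two rates have the same lower and upper limits,
hence converge to the same extended reals.

The left inequality is data processing under measurements, `measuredRelEntropy_le_relEntropy`. In
eigenbases of ρ and σ, D is the classical relative entropy of the families w_ij r_i and w_ij s_j,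
with w_ij the squared overlaps. The sum Σ w r log(s + T r) has T-derivative Σ w r²/(s + T r) and
passes from Σ w r log s at T = 0 to Σ w r log r at infinity, up to log T times the mass. So relative
entropies are ordered as soon as these χ²-type sums are, for every T
(`sum_log_le_of_sum_sq_div_le`). The sums decrease under a measurement by completing squares and by
X² ≤ Σ c_x² E_x for X = Σ c_x E_x (`sum_sq_div_le`).

For the right inequality, a given σ in M_n is replaced by its average τ over permutations. As ρ^{⊗n}
is permutation invariant and D^ALL is convex in σ, this does not increase D^ALL. Invariant matrices
form an algebra of polynomial dimension, so τ has only polynomially many distinct eigenvalues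
(`card_eigenvalues_le_of_mem_permInvariant`). Measuring in an eigenbasis of τ in which the
compressions of ρ^{⊗n} to the eigenspaces are diagonal loses at most the logarithm of their number,
by the pinching inequality (`relEntropy_le_measuredRelEntropy_add`).

The minima are attained because M_n is compact and both divergences are suprema of continuous
functions of σ, hence lower semicontinuous. -/

namespace QRes

open Matrix

/-! ### Spectral data: functional calculus, traces and supports in eigenbases -/

section Diagonalization

variable {κ : Type*} [Fintype κ] [DecidableEq κ]

/-- `σ = U diag(s) U*` with a unitary `U` and real `s`. -/
structure IsDiagonalization (σ U : Matrix κ κ ℂ) (s : κ → ℝ) : Prop where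
  star_mul : star U * U = 1
  eq : σ = U * diagonal (fun i => (s i : ℂ)) * star U

/-- The transition probabilities between the columns of `U` and those of `V`. -/
noncomputable def overlap {κ : Type*} [Fintype κ] (U V : Matrix κ κ ℂ) (i j : κ) : ℝ :=
  Complex.normSq ((star U * V) i j)

lemma overlap_nonneg {κ : Type*} [Fintype κ] (U V : Matrix κ κ ℂ) (i j : κ) : 0 ≤ overlap U V i j :=
  Complex.normSq_nonneg _

lemma IsDiagonalization.mul_star {σ U : Matrix κ κ ℂ} {s : κ → ℝ}
    (h : IsDiagonalization σ U s) : U * star U = 1 :=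
  mul_eq_one_comm.1 h.star_mul

lemma _root_.Matrix.IsHermitian.isDiagonalization {σ : Matrix κ κ ℂ} (h : σ.IsHermitian) :
    IsDiagonalization σ h.eigenvectorUnitary h.eigenvalues where
  star_mul := (Matrix.mem_unitaryGroup_iff').1 h.eigenvectorUnitary.2
  eq := by
    conv_lhs => rw [h.spectral_theorem]
    rfl

lemma IsDiagonalization.isHermitian {σ U : Matrix κ κ ℂ} {s : κ → ℝ}
    (h : IsDiagonalization σ U s) : σ.IsHermitian := by
  rw [h.eq, star_eq_conjTranspose]
  refine isHermitian_mul_mul_conjTranspose _ ?_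
  rw [isHermitian_diagonal_iff]
  intro i
  simp [IsSelfAdjoint]

lemma IsDiagonalization.star_mul_mul {σ U : Matrix κ κ ℂ} {s : κ → ℝ}
    (h : IsDiagonalization σ U s) :
    star U * σ * U = diagonal (fun i => (s i : ℂ)) := by
  rw [h.eq]
  calc star U * (U * diagonal (fun i => (s i : ℂ)) * star U) * U
      = (star U * U) * diagonal (fun i => (s i : ℂ)) * (star U * U) := by
        simp only [Matrix.mul_assoc]
    _ = _ := by simp [h.star_mul]

lemma IsDiagonalization.nonneg {σ U : Matrix κ κ ℂ} {s : κ → ℝ}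
    (h : IsDiagonalization σ U s) (hσ : σ.PosSemidef) (i : κ) : 0 ≤ s i := by
  have h1 := hσ.conjTranspose_mul_mul_same U
  rw [← star_eq_conjTranspose, h.star_mul_mul, posSemidef_diagonal_iff] at h1
  exact_mod_cast h1 i

lemma IsDiagonalization.aeval {σ U : Matrix κ κ ℂ} {s : κ → ℝ}
    (h : IsDiagonalization σ U s) (q : Polynomial ℝ) :
    Polynomial.aeval σ q = U * diagonal (fun i => ((q.eval (s i) : ℝ) : ℂ)) * star U := by
  induction q using Polynomial.induction_on' with
  | add p q hp hq =>
    rw [map_add, hp, hq, ← Matrix.add_mul, ← Matrix.mul_add, diagonal_add]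
    simp
  | monomial n a =>
    rw [Polynomial.aeval_monomial]
    have hpow : σ ^ n = U * diagonal (fun i => ((s i : ℂ)) ^ n) * star U := by
      induction n with
      | zero => simp [h.mul_star]
      | succ n ih =>
        rw [pow_succ, ih]
        nth_rw 1 [h.eq]
        calc _ = U * diagonal (fun i => ((s i : ℂ)) ^ n) * (star U * U) *
              diagonal (fun i => (s i : ℂ)) * star U := by simp only [Matrix.mul_assoc]
          _ = _ := by
            rw [h.star_mul, Matrix.mul_one, Matrix.mul_assoc U, diagonal_mul_diagonal]
            simp [pow_succ]
    rw [hpow, Algebra.algebraMap_eq_smul_one, smul_mul_assoc, one_mul]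
    have : diagonal (fun i => (((Polynomial.monomial n a).eval (s i) : ℝ) : ℂ)) =
        a • diagonal (fun i => ((s i : ℂ)) ^ n) := by
      ext i j
      by_cases hij : i = j
      · subst hij; simp
      · simp [hij]
    rw [this, Matrix.mul_smul, Matrix.smul_mul]

/-- The spectrum is finite, so on it and on the values of s the function f agrees with a Lagrange
interpolation polynomial, for which the formula is algebraic. This needs no continuity of f and
holds for every diagonalization, not only the canonical one. -/
lemma IsDiagonalization.cfc {σ U : Matrix κ κ ℂ} {s : κ → ℝ}
    (h : IsDiagonalization σ U s) (f : ℝ → ℝ) :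
    cfc f σ = U * diagonal (fun i => ((f (s i) : ℝ) : ℂ)) * star U := by
  classical
  have hsa : IsSelfAdjoint σ := h.isHermitian
  set T : Finset ℝ := (Matrix.finite_real_spectrum (A := σ)).toFinset ∪ Finset.univ.image s
  set q := Lagrange.interpolate T id f
  have hq : ∀ x ∈ T, q.eval x = f x := fun x hx =>
    Lagrange.eval_interpolate_at_node (v := id) f Function.injective_id.injOn hx
  have h1 : _root_.cfc f σ = _root_.cfc q.eval σ := by
    apply cfc_congr
    intro x hx
    exact (hq x (by simp [T, hx])).symm
  rw [h1, cfc_polynomial q σ, h.aeval]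
  congr 3
  ext i
  rw [hq _ (by simp [T])]

lemma trace_mul_diagonal_mul {U V : Matrix κ κ ℂ} (r t : κ → ℝ) :
    ((U * diagonal (fun i => (r i : ℂ)) * star U) *
      (V * diagonal (fun i => (t i : ℂ)) * star V)).trace =
      ((∑ i, ∑ j, overlap U V i j * r i * t j : ℝ) : ℂ) := by
  have h1 : ((U * diagonal (fun i => (r i : ℂ)) * star U) *
      (V * diagonal (fun i => (t i : ℂ)) * star V)).trace =
      ((diagonal (fun i => (r i : ℂ)) * (star U * V)) *
        (diagonal (fun i => (t i : ℂ)) * star (star U * V))).trace := by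
    rw [StarMul.star_mul, star_star]
    simp only [Matrix.mul_assoc]
    rw [Matrix.trace_mul_comm U]
    simp only [Matrix.mul_assoc]
  rw [h1, Matrix.trace]
  push_cast
  refine Finset.sum_congr rfl fun i _ => ?_
  rw [diag_apply, Matrix.mul_apply]
  refine Finset.sum_congr rfl fun j _ => ?_
  rw [diagonal_mul, diagonal_mul, star_apply, overlap, ← Complex.mul_conj]
  simp only [RCLike.star_def]
  ring

lemma sum_overlap_right {U V : Matrix κ κ ℂ} (hU : star U * U = 1) (hV : star V * V = 1) (i : κ) :
    ∑ j, overlap U V i j = 1 := by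
  have h : ((star U * V) * star (star U * V)) i i = 1 := by
    rw [StarMul.star_mul, star_star]
    calc _ = (star U * (V * star V) * U) i i := by simp only [Matrix.mul_assoc]
      _ = 1 := by rw [mul_eq_one_comm.1 hV, Matrix.mul_one, hU, one_apply_eq]
  rw [Matrix.mul_apply] at h
  have h2 : ((∑ j, overlap U V i j : ℝ) : ℂ) = 1 := by
    rw [← h]
    push_cast
    refine Finset.sum_congr rfl fun j _ => ?_
    rw [star_apply, overlap, ← Complex.mul_conj]
    rfl
  exact_mod_cast h2

lemma overlap_comm {κ : Type*} [Fintype κ] (U V : Matrix κ κ ℂ) (i j : κ) :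
    overlap U V i j = overlap V U j i := by
  have h : (star V * U) j i = star ((star U * V) i j) := by
    rw [← star_apply, StarMul.star_mul, star_star]
  rw [overlap, overlap, h, RCLike.star_def, Complex.normSq_conj]

lemma IsDiagonalization.trace {σ U : Matrix κ κ ℂ} {s : κ → ℝ}
    (h : IsDiagonalization σ U s) : σ.trace = ((∑ i, s i : ℝ) : ℂ) := by
  rw [h.eq, Matrix.trace_mul_comm, ← Matrix.mul_assoc, h.star_mul, Matrix.one_mul, trace_diagonal]
  push_cast
  rfl

lemma IsDiagonalization.mem_supp {σ U : Matrix κ κ ℂ} {s : κ → ℝ}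
    (h : IsDiagonalization σ U s) (v : κ → ℂ) :
    v ∈ supp σ ↔ ∀ j, s j = 0 → (star U *ᵥ v) j = 0 := by
  constructor
  · rintro ⟨u, rfl⟩ j hj
    rw [mulVecLin_apply, mulVec_mulVec, h.eq, ← Matrix.mul_assoc, ← Matrix.mul_assoc, h.star_mul,
      Matrix.one_mul, ← mulVec_mulVec, mulVec_diagonal, hj]
    simp
  · intro hv
    refine ⟨U *ᵥ (diagonal (fun i => ((s i : ℂ))⁻¹) *ᵥ (star U *ᵥ v)), ?_⟩
    rw [mulVecLin_apply]
    nth_rw 1 [h.eq]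
    rw [mulVec_mulVec, Matrix.mul_assoc, h.star_mul, Matrix.mul_one, ← mulVec_mulVec]
    have : diagonal (fun i => (s i : ℂ)) *ᵥ (diagonal (fun i => ((s i : ℂ))⁻¹) *ᵥ (star U *ᵥ v)) =
        star U *ᵥ v := by
      ext j
      rw [mulVec_diagonal, mulVec_diagonal]
      by_cases hj : s j = 0
      · rw [hv j hj]; simp
      · have : (s j : ℂ) ≠ 0 := by exact_mod_cast hj
        field_simp
    rw [this, mulVec_mulVec, h.mul_star, one_mulVec]

/-- The support is cut out by the vanishing of the coordinates with eigenvalue 0, so the inclusion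
can be tested on the eigenvectors of ρ with r i ≠ 0. -/
lemma supp_le_supp_iff {ρ σ U V : Matrix κ κ ℂ} {r s : κ → ℝ}
    (hρ : IsDiagonalization ρ U r) (hσ : IsDiagonalization σ V s) :
    supp ρ ≤ supp σ ↔ ∀ i j, r i ≠ 0 → s j = 0 → overlap U V i j = 0 := by
  have key : ∀ i j, (star V *ᵥ (U *ᵥ Pi.single i 1)) j = 0 ↔ overlap U V i j = 0 := by
    intro i j
    rw [overlap_comm, overlap, Complex.normSq_eq_zero, mulVec_mulVec, mulVec_single_one]
    rfl
  constructor
  · intro h i j hi hj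
    rw [← key]
    refine (hσ.mem_supp _).1 (h ((hρ.mem_supp _).2 fun k hk => ?_)) j hj
    rw [mulVec_mulVec, hρ.star_mul, one_mulVec, Pi.single_eq_of_ne]
    rintro rfl
    exact hi hk
  · intro h v hv
    rw [hσ.mem_supp]
    intro j hj
    have h1 : star V *ᵥ v = (star V * U) *ᵥ (star U *ᵥ v) := by
      rw [mulVec_mulVec, Matrix.mul_assoc, hρ.mul_star, Matrix.mul_one]
    rw [h1, mulVec, dotProduct]
    refine Finset.sum_eq_zero fun i _ => ?_
    by_cases hi : r i = 0
    · rw [(hρ.mem_supp v).1 hv i hi, mul_zero]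
    · have := h i j hi hj
      rw [overlap_comm, overlap, Complex.normSq_eq_zero] at this
      rw [this, zero_mul]

lemma IsDiagonalization.trace_mul_cfc {ρ σ U V : Matrix κ κ ℂ} {r s : κ → ℝ}
    (hρ : IsDiagonalization ρ U r) (hσ : IsDiagonalization σ V s) (f : ℝ → ℝ) :
    (ρ * _root_.cfc f σ).trace.re = ∑ i, ∑ j, overlap U V i j * r i * f (s j) := by
  rw [hσ.cfc, hρ.eq, trace_mul_diagonal_mul, Complex.ofReal_re]

lemma IsDiagonalization.trace_mul_cfc_self {ρ U : Matrix κ κ ℂ} {r : κ → ℝ}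
    (hρ : IsDiagonalization ρ U r) (f : ℝ → ℝ) :
    (ρ * _root_.cfc f ρ).trace.re = ∑ i, r i * f (r i) := by
  rw [hρ.trace_mul_cfc hρ]
  refine Finset.sum_congr rfl fun i _ => ?_
  rw [Finset.sum_eq_single i]
  · simp [overlap, hρ.star_mul]
  · intro j _ hj
    simp [overlap, hρ.star_mul, one_apply_ne hj.symm]
  · simp

/-- Umegaki relative entropy in terms of eigenvalues and transition probabilities. -/
lemma relEntropy_eq {ρ σ U V : Matrix κ κ ℂ} {r s : κ → ℝ}
    (hρ : IsDiagonalization ρ U r) (hσ : IsDiagonalization σ V s) (h : supp ρ ≤ supp σ) :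
    relEntropy ρ σ = ((∑ i, r i * Real.log (r i) -
      ∑ i, ∑ j, overlap U V i j * r i * Real.log (s j) : ℝ) : EReal) := by
  rw [relEntropy, if_pos h, Matrix.mul_sub, trace_sub, Complex.sub_re, hρ.trace_mul_cfc_self,
    hρ.trace_mul_cfc hσ]

end Diagonalization

/-! ### Scalar comparison of relative entropies through χ²-type sums -/

section Scalar

variable {α : Type*} [Fintype α]

lemma hasDerivAt_sum_mul_log {w r s : α → ℝ} (hr : ∀ a, 0 ≤ r a) (hs : ∀ a, 0 ≤ s a) {T : ℝ}
    (hT : 0 < T) :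
    HasDerivAt (fun T => ∑ a, w a * r a * Real.log (s a + T * r a))
      (∑ a, w a * (r a ^ 2 / (s a + T * r a))) T := by
  refine HasDerivAt.fun_sum fun a _ => ?_
  rcases (hr a).eq_or_lt with h0 | h0
  · simpa [← h0] using hasDerivAt_const T (0 : ℝ)
  · have hpos : 0 < s a + T * r a := add_pos_of_nonneg_of_pos (hs a) (mul_pos hT h0)
    have h1 : HasDerivAt (fun T => s a + T * r a) (r a) T := by
      simpa using ((hasDerivAt_id T).mul_const (r a)).const_add (s a)
    refine ((h1.log hpos.ne').const_mul (w a * r a)).congr_deriv ?_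
    ring

lemma tendsto_sum_mul_log_zero {c s t : α → ℝ} (h : ∀ a, s a = 0 → c a = 0) :
    Tendsto (fun T => ∑ a, c a * Real.log (s a + T * t a)) (𝓝[>] 0)
      (𝓝 (∑ a, c a * Real.log (s a))) := by
  refine tendsto_finsetSum _ fun a _ => ?_
  by_cases h0 : s a = 0
  · simp [h a h0]
  · refine Tendsto.const_mul _ ?_
    have h1 : Tendsto (fun T => s a + T * t a) (𝓝[>] 0) (𝓝 (s a)) := by
      have : Tendsto (fun T => s a + T * t a) (𝓝 0) (𝓝 (s a + 0 * t a)) :=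
        Continuous.tendsto (by fun_prop) _
      rw [zero_mul, add_zero] at this
      exact this.mono_left nhdsWithin_le_nhds
    exact h1.log h0

/-- Here log(s + T r) − log T = log(s/T + r). The subtracted divergence depends only on the total
mass Σ w r, so it cancels between two families of equal mass. -/
lemma tendsto_sum_mul_log_atTop {w r s : α → ℝ} (hr : ∀ a, 0 ≤ r a) (hs : ∀ a, 0 ≤ s a) :
    Tendsto (fun T => ∑ a, w a * r a * Real.log (s a + T * r a) - Real.log T * ∑ a, w a * r a)
      atTop (𝓝 (∑ a, w a * r a * Real.log (r a))) := by
  have h1 : ∀ T, ∑ a, w a * r a * Real.log (s a + T * r a) - Real.log T * ∑ a, w a * r a =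
      ∑ a, w a * r a * (Real.log (s a + T * r a) - Real.log T) := by
    intro T
    rw [Finset.mul_sum, ← Finset.sum_sub_distrib]
    exact Finset.sum_congr rfl fun a _ => by ring
  simp_rw [h1]
  refine tendsto_finsetSum _ fun a _ => ?_
  rcases (hr a).eq_or_lt with h0 | h0
  · simp [← h0]
  · refine Tendsto.const_mul _ ?_
    have h2 : Tendsto (fun T => s a * T⁻¹ + r a) atTop (𝓝 (r a)) := by
      simpa using (tendsto_inv_atTop_zero.const_mul (s a)).add_const (r a)
    refine (h2.log h0.ne').congr' ?_
    filter_upwards [eventually_gt_atTop 0] with T hT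
    have hpos : 0 < s a + T * r a := add_pos_of_nonneg_of_pos (hs a) (mul_pos hT h0)
    rw [← Real.log_div hpos.ne' hT.ne']
    congr 1
    field_simp

/-- If the `χ²`-type quantities of one family dominate those of another one, then so do the
relative entropies. -/
lemma sum_log_le_of_sum_sq_div_le {β : Type*} [Fintype β] {w r s : α → ℝ} {p q : β → ℝ}
    (hr : ∀ a, 0 ≤ r a) (hs : ∀ a, 0 ≤ s a) (hp : ∀ b, 0 ≤ p b) (hq : ∀ b, 0 ≤ q b)
    (hsupp : ∀ a, s a = 0 → w a * r a = 0) (hsum : ∑ a, w a * r a = ∑ b, p b)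
    (h : ∀ T, 0 < T → ∑ b, p b ^ 2 / (q b + T * p b) ≤
      ∑ a, w a * (r a ^ 2 / (s a + T * r a))) (hw : ∀ a, 0 ≤ w a) :
    (∀ b, q b = 0 → p b = 0) ∧ ∑ b, p b * (Real.log (p b) - Real.log (q b)) ≤
      ∑ a, w a * r a * (Real.log (r a) - Real.log (s a)) := by
  -- If q b = 0, the b-th term is p b / T, whereas the right-hand sum stays below its value at T =
  -- 0, which is finite by `hsupp`. Letting T → 0 forces p b = 0.
  have hpq : ∀ b, q b = 0 → p b = 0 := by
    intro b hb
    have hK : ∀ T, 0 < T → p b ≤ T * ∑ a, w a * (r a ^ 2 / s a) := by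
      intro T hT
      have h1 : p b / T ≤ ∑ a, w a * (r a ^ 2 / s a) := by
        calc p b / T = p b ^ 2 / (q b + T * p b) := by
              rw [hb, zero_add]
              rcases (hp b).eq_or_lt with h0 | h0
              · simp [← h0]
              · field_simp
          _ ≤ ∑ b, p b ^ 2 / (q b + T * p b) :=
              Finset.single_le_sum (f := fun b => p b ^ 2 / (q b + T * p b))
                (fun b _ => div_nonneg (sq_nonneg _)
                  (add_nonneg (hq b) (mul_nonneg hT.le (hp b)))) (Finset.mem_univ b)
          _ ≤ _ := h T hT
          _ ≤ _ := by
            refine Finset.sum_le_sum fun a _ => ?_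
            rcases (hs a).eq_or_lt with h0 | h0
            · rcases mul_eq_zero.1 (hsupp a h0.symm) with h2 | h2 <;> simp [h2]
            · gcongr
              · exact hw a
              · nlinarith [mul_nonneg hT.le (hr a)]
      rw [div_le_iff₀ hT] at h1
      linarith
    have h2 : Tendsto (fun T : ℝ => T * ∑ a, w a * (r a ^ 2 / s a)) (𝓝[>] 0) (𝓝 0) := by
      have : Tendsto (fun T : ℝ => T * ∑ a, w a * (r a ^ 2 / s a)) (𝓝 0)
          (𝓝 (0 * ∑ a, w a * (r a ^ 2 / s a))) := Continuous.tendsto (by fun_prop) _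
      rw [zero_mul] at this
      exact this.mono_left nhdsWithin_le_nhds
    refine le_antisymm (ge_of_tendsto h2 ?_) (hp b)
    filter_upwards [self_mem_nhdsWithin] with T hT using hK T hT
  refine ⟨hpq, ?_⟩
  -- The derivative of G is the difference of the two χ²-type sums, so G is monotone. The claim
  -- compares its limit at 0, with logarithms of s and q, to its limit at infinity, with logarithms
  -- of r and p.
  set G : ℝ → ℝ := fun T => ∑ a, w a * r a * Real.log (s a + T * r a) -
    ∑ b, 1 * p b * Real.log (q b + T * p b) with hG
  have hderiv : ∀ T, 0 < T → HasDerivAt G (∑ a, w a * (r a ^ 2 / (s a + T * r a)) -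
      ∑ b, 1 * (p b ^ 2 / (q b + T * p b))) T := fun T hT =>
    (hasDerivAt_sum_mul_log hr hs hT).sub (hasDerivAt_sum_mul_log hp hq hT)
  have hmono : MonotoneOn G (Set.Ioi 0) := by
    apply monotoneOn_of_deriv_nonneg (convex_Ioi 0)
    · exact fun T hT => (hderiv T hT).continuousAt.continuousWithinAt
    · rw [interior_Ioi]
      exact fun T hT => (hderiv T hT).differentiableAt.differentiableWithinAt
    · rw [interior_Ioi]
      intro T hT
      rw [(hderiv T hT).deriv]
      simpa using h T hT
  have htop : Tendsto G atTop (𝓝 (∑ a, w a * r a * Real.log (r a) -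
      ∑ b, 1 * p b * Real.log (p b))) := by
    refine ((tendsto_sum_mul_log_atTop hr hs (w := w)).sub
      (tendsto_sum_mul_log_atTop hp hq (w := fun _ => 1))).congr fun T => ?_
    simp only [one_mul, hG, hsum]
    ring
  have hzero : Tendsto G (𝓝[>] 0) (𝓝 (∑ a, w a * r a * Real.log (s a) -
      ∑ b, 1 * p b * Real.log (q b))) :=
    (tendsto_sum_mul_log_zero hsupp).sub
      (tendsto_sum_mul_log_zero fun b hb => by rw [hpq b hb, mul_zero])
  have hle : ∑ a, w a * r a * Real.log (s a) - ∑ b, 1 * p b * Real.log (q b) ≤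
      ∑ a, w a * r a * Real.log (r a) - ∑ b, 1 * p b * Real.log (p b) := by
    refine le_of_tendsto hzero ?_
    filter_upwards [self_mem_nhdsWithin] with T hT
    refine ge_of_tendsto htop ?_
    filter_upwards [eventually_ge_atTop T] with T' hT'
    exact hmono hT (lt_of_lt_of_le hT hT') hT'
  simp only [mul_sub, Finset.sum_sub_distrib]
  simp only [one_mul] at hle
  linarith

end Scalar

/-! ### Data processing for measurements -/

section DataProcessing

lemma coe_sum {α : Type*} (t : Finset α) (f : α → ℝ) :
    ((∑ a ∈ t, f a : ℝ) : EReal) = ∑ a ∈ t, (f a : EReal) :=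
  map_sum (⟨⟨fun x : ℝ => (x : EReal), EReal.coe_zero⟩, EReal.coe_add⟩ : ℝ →+ EReal) f t

lemma klTerm_eq_coe {p q : ℝ} (h : q = 0 → p = 0) :
    klTerm p q = ((p * (Real.log p - Real.log q) : ℝ) : EReal) := by
  rw [klTerm]
  split_ifs with h1 h2
  · simp [h1]
  · exact absurd (h h2) h1
  · rw [Real.log_div h1 h2]

variable {κ : Type*} [Fintype κ] [DecidableEq κ]

open scoped MatrixOrder Matrix.Norms.L2Operator in
lemma trace_mul_re_nonneg {A B : Matrix κ κ ℂ} (hA : A.PosSemidef) (hB : B.PosSemidef) :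
    0 ≤ (A * B).trace.re := by
  obtain ⟨C, rfl⟩ := CStarAlgebra.nonneg_iff_eq_star_mul_self.mp hA.nonneg
  rw [Matrix.mul_assoc, Matrix.trace_mul_comm, star_eq_conjTranspose]
  exact (Complex.le_def.1 (hB.mul_mul_conjTranspose_same C).trace_nonneg).1

lemma IsDiagonalization.trace_mul_mul_star {ρ U : Matrix κ κ ℂ} {r : κ → ℝ}
    (hρ : IsDiagonalization ρ U r) (Y Z : Matrix κ κ ℂ) :
    (ρ * (Y * star Z)).trace = ∑ i, ∑ j, r i * ((star U * Y) i j * star ((star U * Z) i j)) := by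
  have h1 : (ρ * (Y * star Z)).trace =
      ((diagonal (fun i => (r i : ℂ)) * (star U * Y)) * star (star U * Z)).trace := by
    rw [StarMul.star_mul, star_star]
    nth_rw 1 [hρ.eq]
    simp only [Matrix.mul_assoc]
    rw [Matrix.trace_mul_comm U]
    simp only [Matrix.mul_assoc]
  rw [h1, Matrix.trace]
  refine Finset.sum_congr rfl fun i _ => ?_
  rw [diag_apply, Matrix.mul_apply]
  refine Finset.sum_congr rfl fun j _ => ?_
  rw [diagonal_mul, star_apply]
  ring

lemma IsDiagonalization.trace_mul_eq_sum {ρ U V : Matrix κ κ ℂ} {r : κ → ℝ}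
    (hρ : IsDiagonalization ρ U r) (hV : V * star V = 1) (X : Matrix κ κ ℂ) :
    (ρ * X).trace.re =
      ∑ i, ∑ j, r i * ((star U * X * V) i j * star ((star U * V) i j)).re := by
  have h := hρ.trace_mul_mul_star (X * V) V
  rw [Matrix.mul_assoc X, hV, Matrix.mul_one, ← Matrix.mul_assoc] at h
  rw [h, Complex.re_sum]
  refine Finset.sum_congr rfl fun i _ => ?_
  rw [Complex.re_sum]
  exact Finset.sum_congr rfl fun j _ => Complex.re_ofReal_mul _ _

lemma IsDiagonalization.trace_mul_sq_eq_sum {ρ U V : Matrix κ κ ℂ} {r : κ → ℝ}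
    (hρ : IsDiagonalization ρ U r) (hV : V * star V = 1) {X : Matrix κ κ ℂ}
    (hX : X.IsHermitian) :
    (ρ * (X * X)).trace.re = ∑ i, ∑ j, r i * Complex.normSq ((star U * X * V) i j) := by
  have h := hρ.trace_mul_mul_star (X * V) (X * V)
  have h2 : X * V * star (X * V) = X * X := by
    rw [StarMul.star_mul, star_eq_conjTranspose X, hX.eq]
    calc _ = X * (V * star V) * X := by simp only [Matrix.mul_assoc]
      _ = _ := by rw [hV, Matrix.mul_one]
  rw [h2, ← Matrix.mul_assoc (star U)] at h
  rw [h, Complex.re_sum]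
  refine Finset.sum_congr rfl fun i _ => ?_
  rw [Complex.re_sum]
  refine Finset.sum_congr rfl fun j _ => ?_
  rw [RCLike.star_def, Complex.mul_conj, ← Complex.ofReal_mul, Complex.ofReal_re]

/-- Expansion of |(s + T r) A − r B|² ≥ 0, divided by s + T r. For r = 0 the right side is 0 and the
left side is −s |A|². -/
lemma re_mul_star_le {A B : ℂ} {r s T : ℝ} (hr : 0 ≤ r) (hs : 0 ≤ s) (hT : 0 < T) :
    2 * (r * (A * star B).re) - (s + T * r) * Complex.normSq A ≤
      Complex.normSq B * (r ^ 2 / (s + T * r)) := by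
  rcases hr.eq_or_lt with h0 | h0
  · simp [← h0]
    exact mul_nonneg hs (Complex.normSq_nonneg A)
  · have hpos : 0 < s + T * r := add_pos_of_nonneg_of_pos hs (mul_pos hT h0)
    rw [mul_div_assoc', le_div_iff₀ hpos]
    simp only [Complex.normSq_apply, RCLike.star_def, Complex.mul_re, Complex.conj_re,
      Complex.conj_im]
    nlinarith [sq_nonneg ((s + T * r) * A.re - r * B.re),
      sq_nonneg ((s + T * r) * A.im - r * B.im)]

/-- Data processing for `χ²`-type quantities under measurements. -/
lemma sum_sq_div_le {ρ σ U V : Matrix κ κ ℂ} {r s : κ → ℝ}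
    (hρ : IsDiagonalization ρ U r) (hσ : IsDiagonalization σ V s)
    (hρ0 : ρ.PosSemidef) (hσ0 : σ.PosSemidef) {k : ℕ} {E : Fin k → Matrix κ κ ℂ}
    (hE : IsPOVM E) {T : ℝ} (hT : 0 < T) :
    ∑ x, (ρ * E x).trace.re ^ 2 / ((σ * E x).trace.re + T * (ρ * E x).trace.re) ≤
      ∑ i, ∑ j, overlap U V i j * (r i ^ 2 / (s j + T * r i)) := by
  set p := fun x => (ρ * E x).trace.re
  set q := fun x => (σ * E x).trace.re
  -- The maximizer of 2 c p − c² (q + T p), whose maximum is p²/(q + T p); it is 0 by the division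
  -- convention when the denominator vanishes.
  set c := fun x => p x / (q x + T * p x) with hc
  set X : Matrix κ κ ℂ := ∑ x, (c x : ℂ) • E x with hX
  have hXh : X.IsHermitian := by
    rw [Matrix.IsHermitian, hX, conjTranspose_sum]
    refine Finset.sum_congr rfl fun x _ => ?_
    rw [conjTranspose_smul, (hE.posSemidef x).isHermitian.eq]
    simp
  -- The operator inequality X² ≤ Σ c_x² E_x, from Σ (c_x − X) E_x (c_x − X) ≥ 0 and Σ E_x = 1.
  have hsq : ∀ {τ : Matrix κ κ ℂ}, τ.PosSemidef →
      (τ * (X * X)).trace.re ≤ ∑ x, c x ^ 2 * (τ * E x).trace.re := by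
    intro τ hτ
    have h1 : ∑ x, ((c x : ℂ) • (1 : Matrix κ κ ℂ) - X) * E x * ((c x : ℂ) • 1 - X) =
        ∑ x, ((c x : ℂ) ^ 2) • E x - X * X := by
      have h2 : ∀ x, ((c x : ℂ) • (1 : Matrix κ κ ℂ) - X) * E x * ((c x : ℂ) • 1 - X) =
          ((c x : ℂ) ^ 2) • E x - X * ((c x : ℂ) • E x) - ((c x : ℂ) • E x) * X +
            X * E x * X := by
        intro x
        simp only [sub_mul, mul_sub, smul_mul_assoc, mul_smul_comm, one_mul, mul_one, smul_smul,
          smul_sub, pow_two]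
        abel
      simp_rw [h2]
      rw [Finset.sum_add_distrib, Finset.sum_sub_distrib, Finset.sum_sub_distrib,
        ← Finset.mul_sum, ← Finset.sum_mul, ← hX, ← Finset.sum_mul, ← Finset.mul_sum, hE.sum_eq_one,
        Matrix.mul_one]
      abel
    have h3 : (∑ x, ((c x : ℂ) • (1 : Matrix κ κ ℂ) - X) * E x *
        ((c x : ℂ) • 1 - X)).PosSemidef := by
      refine posSemidef_sum _ fun x _ => ?_
      have h4 : (((c x : ℂ) • (1 : Matrix κ κ ℂ) - X)).conjTranspose =
          (c x : ℂ) • (1 : Matrix κ κ ℂ) - X := by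
        rw [conjTranspose_sub, hXh.eq, conjTranspose_smul, conjTranspose_one]
        simp
      have := (hE.posSemidef x).mul_mul_conjTranspose_same ((c x : ℂ) • (1 : Matrix κ κ ℂ) - X)
      rwa [h4] at this
    have h5 := trace_mul_re_nonneg hτ h3
    rw [h1, Matrix.mul_sub, trace_sub, Complex.sub_re, sub_nonneg] at h5
    refine h5.trans_eq ?_
    rw [Matrix.mul_sum, trace_sum, Complex.re_sum]
    refine Finset.sum_congr rfl fun x _ => ?_
    rw [Matrix.mul_smul, trace_smul, smul_eq_mul, ← Complex.ofReal_pow, Complex.re_ofReal_mul]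
  have hlhs : ∑ x, p x ^ 2 / (q x + T * p x) ≤
      2 * (ρ * X).trace.re - ((σ * (X * X)).trace.re + T * (ρ * (X * X)).trace.re) := by
    have h1 : (ρ * X).trace.re = ∑ x, c x * p x := by
      rw [hX, Matrix.mul_sum, trace_sum, Complex.re_sum]
      refine Finset.sum_congr rfl fun x _ => ?_
      rw [Matrix.mul_smul, trace_smul, smul_eq_mul, Complex.re_ofReal_mul]
    have h2 : ∑ x, p x ^ 2 / (q x + T * p x) =
        2 * ∑ x, c x * p x - (∑ x, c x ^ 2 * q x + T * ∑ x, c x ^ 2 * p x) := by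
      rw [Finset.mul_sum, Finset.mul_sum, ← Finset.sum_add_distrib, ← Finset.sum_sub_distrib]
      refine Finset.sum_congr rfl fun x _ => ?_
      by_cases h0 : q x + T * p x = 0
      · simp [hc, h0]
      · simp only [hc]
        field_simp
        ring
    rw [h1, h2]
    have := hsq hσ0
    have := mul_le_mul_of_nonneg_left (hsq hρ0) hT.le
    linarith
  -- The bound is now a sum over the entries A of U* X V, and completing the square in each entry,
  -- with B the entry of U* V, suffices.
  refine hlhs.trans ?_
  have hσX : (σ * (X * X)).trace.re =
      ∑ i, ∑ j, s j * Complex.normSq ((star U * X * V) i j) := by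
    rw [hσ.trace_mul_sq_eq_sum hρ.mul_star hXh, Finset.sum_comm]
    refine Finset.sum_congr rfl fun i _ => Finset.sum_congr rfl fun j _ => ?_
    have : (star V * X * U) j i = star ((star U * X * V) i j) := by
      rw [← star_apply, StarMul.star_mul, StarMul.star_mul, star_star, star_eq_conjTranspose X,
        hXh.eq, Matrix.mul_assoc]
    rw [this, RCLike.star_def, Complex.normSq_conj]
  rw [hρ.trace_mul_eq_sum hσ.mul_star, hσX, hρ.trace_mul_sq_eq_sum hσ.mul_star hXh]
  simp only [Finset.mul_sum, ← Finset.sum_add_distrib, ← Finset.sum_sub_distrib]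
  refine Finset.sum_le_sum fun i _ => Finset.sum_le_sum fun j _ => ?_
  refine le_trans (le_of_eq ?_)
    (re_mul_star_le (hρ.nonneg hρ0 i) (hσ.nonneg hσ0 j) hT (A := (star U * X * V) i j))
  ring

/-- Data processing: measurements do not increase the relative entropy. -/
theorem measuredRelEntropy_le_relEntropy {ρ σ : Matrix κ κ ℂ} (hρ : ρ ∈ densityMatrices κ)
    (hσ : σ ∈ densityMatrices κ) : measuredRelEntropy ρ σ ≤ relEntropy ρ σ := by
  by_cases hsupp : supp ρ ≤ supp σ
  swap
  · rw [relEntropy, if_neg hsupp]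
    exact le_top
  refine iSup_le fun k => iSup_le fun E => iSup_le fun hE => ?_
  have hU := hρ.1.isHermitian.isDiagonalization
  have hV := hσ.1.isHermitian.isDiagonalization
  set U : Matrix κ κ ℂ := hρ.1.isHermitian.eigenvectorUnitary.1
  set V : Matrix κ κ ℂ := hσ.1.isHermitian.eigenvectorUnitary.1
  set r := hρ.1.isHermitian.eigenvalues
  set s := hσ.1.isHermitian.eigenvalues
  have hw := (supp_le_supp_iff hU hV).1 hsupp
  have hr1 : ∑ i, r i = 1 := by
    have := hU.trace
    rw [hρ.2] at this
    exact_mod_cast this.symm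
  have hwr : ∀ i, ∑ j, overlap U V i j * r i = r i := fun i => by
    rw [← Finset.sum_mul, sum_overlap_right hU.star_mul hV.star_mul, one_mul]
  have hp1 : ∑ x, (ρ * E x).trace.re = 1 := by
    rw [← Complex.re_sum, ← trace_sum, ← Matrix.mul_sum, hE.sum_eq_one, Matrix.mul_one, hρ.2,
      Complex.one_re]
  -- The pairs (i, j) of eigenvectors index the classical model of D, with the overlaps as common
  -- weights.
  obtain ⟨h1, h2⟩ := sum_log_le_of_sum_sq_div_le (α := κ × κ) (β := Fin k)
    (w := fun a => overlap U V a.1 a.2) (r := fun a => r a.1) (s := fun a => s a.2)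
    (p := fun x => (ρ * E x).trace.re) (q := fun x => (σ * E x).trace.re)
    (fun a => hU.nonneg hρ.1 a.1) (fun a => hV.nonneg hσ.1 a.2)
    (fun x => trace_mul_re_nonneg hρ.1 (hE.posSemidef x))
    (fun x => trace_mul_re_nonneg hσ.1 (hE.posSemidef x))
    (fun a ha => by
      by_cases h0 : r a.1 = 0
      · rw [h0, mul_zero]
      · rw [hw a.1 a.2 h0 ha, zero_mul])
    (by rw [Fintype.sum_prod_type, hp1]; simp only [hwr]; exact hr1)
    (fun T hT => by
      rw [Fintype.sum_prod_type]
      exact sum_sq_div_le hU hV hρ.1 hσ.1 hE hT)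
    (fun a => overlap_nonneg _ _ _ _)
  rw [relEntropy_eq hU hV hsupp]
  have h3 : ∑ x, klTerm (ρ * E x).trace.re (σ * E x).trace.re =
      ((∑ x, (ρ * E x).trace.re * (Real.log (ρ * E x).trace.re -
        Real.log (σ * E x).trace.re) : ℝ) : EReal) := by
    rw [coe_sum]
    exact Finset.sum_congr rfl fun x _ => klTerm_eq_coe (h1 x)
  rw [h3]
  refine EReal.coe_le_coe (h2.trans_eq ?_)
  rw [Fintype.sum_prod_type, ← Finset.sum_sub_distrib]
  refine Finset.sum_congr rfl fun i _ => ?_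
  simp only [mul_sub, Finset.sum_sub_distrib, ← Finset.sum_mul, hwr]

end DataProcessing

/-! ### Pinching: the loss when measuring in an eigenbasis of the second state -/

section Pinching

variable {κ : Type*} [Fintype κ] [DecidableEq κ]

/-- A block-diagonal unitary diagonalizing the diagonal blocks, given by the fibres of `f`, of a
Hermitian matrix. -/
lemma exists_unitary_diagonalizing_blocks {α : Type*} (f : κ → α) {R : Matrix κ κ ℂ}
    (hR : R.IsHermitian) :
    ∃ W : Matrix κ κ ℂ, star W * W = 1 ∧ (∀ i j, f i ≠ f j → W i j = 0) ∧
      ∀ j k, j ≠ k → f j = f k → (star W * R * W) j k = 0 := by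
  classical
  -- Passing to the range of f makes the set of blocks finite.
  set g : κ → Set.range f := Set.rangeFactorization f
  have hg : ∀ {i j}, g i = g j ↔ f i = f j := fun {i j} => by
    simp only [g, Set.rangeFactorization, Subtype.mk.injEq]
  let e : (Σ a : Set.range f, {i // g i = a}) ≃ κ := Equiv.sigmaFiberEquiv g
  have he : ∀ x, g (e x) = x.1 := fun x => x.2.2
  let B : ∀ a : Set.range f, Matrix {i // g i = a} {i // g i = a} ℂ :=
    fun a => R.submatrix Subtype.val Subtype.val
  have hB : ∀ a, (B a).IsHermitian := fun a => hR.submatrix _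
  let w : ∀ a : Set.range f, Matrix {i // g i = a} {i // g i = a} ℂ :=
    fun a => (hB a).eigenvectorUnitary.1
  have hw : ∀ a, star (w a) * w a = 1 := fun a => (hB a).isDiagonalization.star_mul
  let W := blockDiagonal' w
  have hWeq : ∀ a x y, W ⟨a, x⟩ ⟨a, y⟩ = w a x y := fun a x y => blockDiagonal'_apply_eq w a x y
  have hWne : ∀ a b x y, a ≠ b → W ⟨a, x⟩ ⟨b, y⟩ = 0 := fun a b x y h =>
    blockDiagonal'_apply_ne w x y h
  have hW : star W * W = 1 := by
    have h1 : star W = blockDiagonal' fun a => star (w a) := by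
      rw [star_eq_conjTranspose, blockDiagonal'_conjTranspose]
      rfl
    rw [h1, ← blockDiagonal'_mul]
    simp_rw [hw]
    exact blockDiagonal'_one
  have hsub : ∀ X : Matrix κ κ ℂ, ∀ j k, (star (W.submatrix e.symm e.symm) * X *
      W.submatrix e.symm e.symm) (e j) (e k) = (star W * X.submatrix e e * W) j k := by
    intro X j k
    have h1 : X = (X.submatrix e e).submatrix e.symm e.symm := by simp
    have h2 : star (W.submatrix e.symm e.symm) = (star W).submatrix e.symm e.symm := by
      simp only [star_eq_conjTranspose, conjTranspose_submatrix]
    nth_rw 1 [h1]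
    rw [h2, submatrix_mul_equiv, submatrix_mul_equiv, submatrix_apply, Equiv.symm_apply_apply,
      Equiv.symm_apply_apply]
  refine ⟨W.submatrix e.symm e.symm, ?_, ?_, ?_⟩
  · have h2 : star (W.submatrix e.symm e.symm) = (star W).submatrix e.symm e.symm := by
      simp only [star_eq_conjTranspose, conjTranspose_submatrix]
    rw [h2, submatrix_mul_equiv, hW, submatrix_one_equiv]
  · intro i j hij
    obtain ⟨x, rfl⟩ := e.surjective i
    obtain ⟨y, rfl⟩ := e.surjective j
    rw [submatrix_apply, Equiv.symm_apply_apply, Equiv.symm_apply_apply]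
    refine hWne _ _ _ _ fun h => hij (hg.1 ?_)
    rw [he, he, h]
  · intro j k hjk hf
    obtain ⟨⟨a, x⟩, rfl⟩ := e.surjective j
    obtain ⟨⟨b, y⟩, rfl⟩ := e.surjective k
    have hab : a = b := by
      have := hg.2 hf
      rwa [he, he] at this
    subst hab
    have hxy : x ≠ y := fun h => hjk (by rw [h])
    rw [hsub]
    have h3 : (star W * R.submatrix e e * W) ⟨a, x⟩ ⟨a, y⟩ = (star (w a) * B a * w a) x y := by
      rw [Matrix.mul_apply, Fintype.sum_sigma, Finset.sum_eq_single a]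
      · rw [Matrix.mul_apply]
        refine Finset.sum_congr rfl fun z _ => ?_
        congr 1
        · rw [Matrix.mul_apply, Fintype.sum_sigma, Finset.sum_eq_single a]
          · rw [Matrix.mul_apply]
            refine Finset.sum_congr rfl fun z' _ => ?_
            rw [star_apply, star_apply, hWeq]
            rfl
          · intro b _ hb
            refine Finset.sum_eq_zero fun z' _ => ?_
            rw [star_apply, hWne _ _ _ _ hb, star_zero, zero_mul]
          · simp
        · exact hWeq _ _ _
      · intro b _ hb
        refine Finset.sum_eq_zero fun z' _ => ?_
        rw [hWne _ _ _ _ hb, mul_zero]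
      · simp
    rw [h3, (hB a).isDiagonalization.star_mul_mul, diagonal_apply_ne _ hxy]

/-- An eigenbasis of `σ` in which the compressions of `ρ` to the eigenspaces of `σ` are diagonal. -/
lemma exists_isDiagonalization_adapted {ρ σ : Matrix κ κ ℂ} (hρ : ρ.IsHermitian)
    (hσ : σ.IsHermitian) :
    ∃ (V : Matrix κ κ ℂ) (s : κ → ℝ), IsDiagonalization σ V s ∧
      ∀ j k, j ≠ k → s j = s k → (star V * ρ * V) j k = 0 := by
  have h0 := hσ.isDiagonalization
  set V₀ : Matrix κ κ ℂ := hσ.eigenvectorUnitary.1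
  set s := hσ.eigenvalues
  have hR : (star V₀ * ρ * V₀).IsHermitian := by
    rw [star_eq_conjTranspose]
    exact isHermitian_conjTranspose_mul_mul _ hρ
  obtain ⟨W, hW, hWs, hWd⟩ := exists_unitary_diagonalizing_blocks s hR
  -- W mixes only equal eigenvalues, so it commutes with diag(s) and V₀ W still diagonalizes σ.
  have hcomm : W * diagonal (fun i => (s i : ℂ)) = diagonal (fun i => (s i : ℂ)) * W := by
    ext i j
    rw [mul_diagonal, diagonal_mul]
    by_cases hij : s i = s j
    · rw [hij, mul_comm]
    · rw [hWs i j hij, mul_zero, zero_mul]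
  refine ⟨V₀ * W, s, ⟨?_, ?_⟩, ?_⟩
  · rw [StarMul.star_mul]
    calc _ = star W * (star V₀ * V₀) * W := by simp only [Matrix.mul_assoc]
      _ = 1 := by rw [h0.star_mul, Matrix.mul_one, hW]
  · rw [StarMul.star_mul]
    calc σ = V₀ * diagonal (fun i => (s i : ℂ)) * (W * star W) * star V₀ := by
          rw [mul_eq_one_comm.1 hW, Matrix.mul_one]
          exact h0.eq
      _ = V₀ * (diagonal (fun i => (s i : ℂ)) * W) * star W * star V₀ := by
          simp only [Matrix.mul_assoc]
      _ = _ := by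
          rw [← hcomm]
          simp only [Matrix.mul_assoc]
  · intro j k hjk hs
    rw [← hWd j k hjk hs, StarMul.star_mul]
    simp only [Matrix.mul_assoc]

/-- The probability of the `j`-th outcome when `ρ` is measured in the basis `V`. -/
lemma IsDiagonalization.diag_apply_eq_sum {ρ U : Matrix κ κ ℂ} {r : κ → ℝ}
    (hρ : IsDiagonalization ρ U r) (V : Matrix κ κ ℂ) (j k : κ) :
    (star V * ρ * V) j k =
      ∑ i, (r i : ℂ) * (star ((star U * V) i j) * (star U * V) i k) := by
  have h : star V * ρ * V = star (star U * V) * (diagonal (fun i => (r i : ℂ)) * (star U * V)) := by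
    rw [StarMul.star_mul, star_star]
    nth_rw 1 [hρ.eq]
    simp only [Matrix.mul_assoc]
  rw [h, Matrix.mul_apply]
  refine Finset.sum_congr rfl fun i _ => ?_
  rw [diagonal_mul, star_apply]
  ring

lemma normSq_sum_le {α : Type*} (t : Finset α) (z : α → ℂ) :
    Complex.normSq (∑ a ∈ t, z a) ≤ t.card * ∑ a ∈ t, Complex.normSq (z a) := by
  simp only [Complex.normSq_eq_norm_sq]
  calc ‖∑ a ∈ t, z a‖ ^ 2 ≤ (∑ a ∈ t, ‖z a‖) ^ 2 := by
        gcongr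
        exact norm_sum_le _ _
    _ ≤ _ := sq_sum_le_card_mul_sum_sq

/-- The pinching inequality, for a basis adapted to the eigenspaces. -/
lemma pinching_inequality {ρ U V : Matrix κ κ ℂ} {r s : κ → ℝ}
    (hρ : IsDiagonalization ρ U r) (hr : ∀ i, 0 ≤ r i)
    (hV : ∀ j k, j ≠ k → s j = s k → (star V * ρ * V) j k = 0) (φ : κ → ℂ) :
    ∑ i, r i * Complex.normSq (∑ j, (star U * V) i j * φ j) ≤
      (Finset.univ.image s).card *
        ∑ j, (∑ i, overlap U V i j * r i) * Complex.normSq (φ j) := by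
  set B := star U * V with hB
  -- Cauchy–Schwarz over the distinct eigenvalues; the factor in the pinching inequality arises
  -- here.
  have h1 : ∀ i, Complex.normSq (∑ j, B i j * φ j) ≤ (Finset.univ.image s).card *
      ∑ a ∈ Finset.univ.image s, Complex.normSq (∑ j with s j = a, B i j * φ j) := by
    intro i
    rw [← Finset.sum_fiberwise_of_maps_to (s := Finset.univ) (t := Finset.univ.image s) (g := s)
      (fun j _ => Finset.mem_image_of_mem s (Finset.mem_univ j))]
    exact normSq_sum_le _ _
  -- Within one eigenvalue the cross terms are off-diagonal entries of V* ρ V, which vanish by `hV`.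
  have h2 : ∀ a, ∑ i, r i * Complex.normSq (∑ j with s j = a, B i j * φ j) =
      ∑ j with s j = a, (∑ i, overlap U V i j * r i) * Complex.normSq (φ j) := by
    intro a
    rw [← Complex.ofReal_inj]
    push_cast
    simp_rw [Complex.normSq_eq_conj_mul_self, map_sum, Finset.sum_mul_sum, Finset.mul_sum]
    rw [Finset.sum_comm]
    refine Finset.sum_congr rfl fun j hj => ?_
    rw [Finset.sum_comm]
    have h3 : ∀ k, ∑ i, (r i : ℂ) * ((starRingEnd ℂ) (B i j * φ j) * (B i k * φ k)) =
        (star V * ρ * V) j k * ((starRingEnd ℂ) (φ j) * φ k) := by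
      intro k
      rw [hρ.diag_apply_eq_sum, Finset.sum_mul]
      refine Finset.sum_congr rfl fun i _ => ?_
      rw [map_mul, RCLike.star_def]
      ring
    simp_rw [h3]
    rw [Finset.sum_eq_single j]
    · rw [hρ.diag_apply_eq_sum]
      congr 1
      refine Finset.sum_congr rfl fun i _ => ?_
      rw [overlap, Complex.normSq_eq_conj_mul_self, mul_comm]
      rfl
    · intro k hk hkj
      rw [hV j k hkj.symm, zero_mul]
      rw [(Finset.mem_filter.1 hj).2, (Finset.mem_filter.1 hk).2]
    · exact fun h => absurd hj h
  calc ∑ i, r i * Complex.normSq (∑ j, B i j * φ j)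
      ≤ ∑ i, r i * ((Finset.univ.image s).card *
        ∑ a ∈ Finset.univ.image s, Complex.normSq (∑ j with s j = a, B i j * φ j)) :=
        Finset.sum_le_sum fun i _ => mul_le_mul_of_nonneg_left (h1 i) (hr i)
    _ = (Finset.univ.image s).card * ∑ a ∈ Finset.univ.image s,
          ∑ i, r i * Complex.normSq (∑ j with s j = a, B i j * φ j) := by
        rw [Finset.sum_comm, Finset.mul_sum]
        refine Finset.sum_congr rfl fun i _ => ?_
        rw [← Finset.mul_sum]
        ring
    _ = _ := by
        simp_rw [h2]
        rw [Finset.sum_fiberwise_of_maps_to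
          (fun j _ => Finset.mem_image_of_mem s (Finset.mem_univ j))]

/-- With N the number of eigenvalues, ρ ≤ N P(ρ) for the pinched state P(ρ) yields r_i ⟨u_i, P(ρ)⁻¹
u_i⟩ ≤ N. Test the inequality on P(ρ)⁻¹ u_i and keep only the i-th term on the left: r_i S² ≤ N S,
and S cancels. Division by zero acts as the inverse on the support. -/
lemma eigenvalue_mul_sum_div_le {ρ U V : Matrix κ κ ℂ} {r s : κ → ℝ}
    (hρ : IsDiagonalization ρ U r) (hr : ∀ i, 0 ≤ r i)
    (hV : ∀ j k, j ≠ k → s j = s k → (star V * ρ * V) j k = 0) (i : κ) :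
    r i * ∑ j, overlap U V i j / (∑ l, overlap U V l j * r l) ≤
      (Finset.univ.image s).card := by
  set p : κ → ℝ := fun j => ∑ l, overlap U V l j * r l with hp
  have hp0 : ∀ j, 0 ≤ p j := fun j =>
    Finset.sum_nonneg fun l _ => mul_nonneg (overlap_nonneg _ _ _ _) (hr l)
  set S := ∑ j, overlap U V i j / p j with hS
  have hS0 : 0 ≤ S := Finset.sum_nonneg fun j _ => div_nonneg (overlap_nonneg _ _ _ _) (hp0 j)
  have h := pinching_inequality hρ hr hV
    (fun j => (starRingEnd ℂ) ((star U * V) i j) / (p j : ℂ))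
  have h1 : ∑ j, (star U * V) i j * ((starRingEnd ℂ) ((star U * V) i j) / (p j : ℂ)) =
      (S : ℂ) := by
    rw [hS]
    push_cast
    refine Finset.sum_congr rfl fun j _ => ?_
    rw [mul_div_assoc', Complex.mul_conj, overlap]
  have h2 : ∑ j, p j * Complex.normSq ((starRingEnd ℂ) ((star U * V) i j) / (p j : ℂ)) = S := by
    refine Finset.sum_congr rfl fun j _ => ?_
    rw [Complex.normSq_div, Complex.normSq_conj, Complex.normSq_ofReal, overlap]
    by_cases h0 : p j = 0
    · simp [h0]
    · field_simp
  rw [h2] at h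
  have h3 : r i * (S * S) ≤ (Finset.univ.image s).card * S := by
    refine le_trans ?_ h
    have := Finset.single_le_sum (f := fun l => r l * Complex.normSq (∑ j, (star U * V) l j *
      ((starRingEnd ℂ) ((star U * V) i j) / (p j : ℂ))))
      (fun l _ => mul_nonneg (hr l) (Complex.normSq_nonneg _)) (Finset.mem_univ i)
    beta_reduce at this
    rwa [h1, Complex.normSq_ofReal] at this
  rcases hS0.eq_or_lt with h0 | h0
  · rw [← h0, mul_zero]
    positivity
  · rw [← mul_assoc] at h3
    exact le_of_mul_le_mul_right h3 h0

/-- Pinching increases the entropy by at most the logarithm of the number of eigenvalues. -/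
lemma sum_overlap_log_le {ρ U V : Matrix κ κ ℂ} {r s : κ → ℝ}
    (hρ : IsDiagonalization ρ U r) (hr : ∀ i, 0 ≤ r i) (hr1 : ∑ i, r i = 1)
    (hVu : star V * V = 1)
    (hV : ∀ j k, j ≠ k → s j = s k → (star V * ρ * V) j k = 0) :
    ∑ i, ∑ j, overlap U V i j * r i *
      (Real.log (r i) - Real.log (∑ l, overlap U V l j * r l)) ≤
      Real.log (Finset.univ.image s).card := by
  set p : κ → ℝ := fun j => ∑ l, overlap U V l j * r l with hp
  set N : ℝ := ((Finset.univ.image s).card : ℝ) with hN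
  have hNpos : 0 < N := by
    have : Nonempty κ := by
      by_contra hne
      rw [not_nonempty_iff] at hne
      simp at hr1
    rw [hN, Nat.cast_pos, Finset.card_pos]
    exact Finset.univ_nonempty.image s
  -- This is log x ≤ x − 1 at x = r i / (p j N): after summation the linear term is at most 1 and
  -- cancels the −1, leaving log N.
  have hterm : ∀ i j, overlap U V i j * r i * (Real.log (r i) - Real.log (p j)) ≤
      overlap U V i j * r i * (Real.log N - 1) +
        r i * (r i * (overlap U V i j / p j)) / N := by
    intro i j
    have hw := overlap_nonneg U V i j
    rcases hw.eq_or_lt with h0 | h0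
    · simp [← h0]
    rcases (hr i).eq_or_lt with h1 | h1
    · simp [← h1]
    have hpj : 0 < p j := lt_of_lt_of_le (mul_pos h0 h1)
      (Finset.single_le_sum (f := fun l => overlap U V l j * r l)
        (fun l _ => mul_nonneg (overlap_nonneg _ _ _ _) (hr l)) (Finset.mem_univ i))
    have hlog := Real.log_le_sub_one_of_pos (div_pos h1 (mul_pos hpj hNpos))
    rw [Real.log_div h1.ne' (mul_pos hpj hNpos).ne', Real.log_mul hpj.ne' hNpos.ne'] at hlog
    calc overlap U V i j * r i * (Real.log (r i) - Real.log (p j))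
        ≤ overlap U V i j * r i * (Real.log N - 1 + r i / (p j * N)) := by
          gcongr
          linarith
      _ = _ := by
          field_simp
  have hwr : ∀ i, ∑ j, overlap U V i j = 1 := sum_overlap_right hρ.star_mul hVu
  calc _ ≤ ∑ i, ∑ j, (overlap U V i j * r i * (Real.log N - 1) +
        r i * (r i * (overlap U V i j / p j)) / N) :=
        Finset.sum_le_sum fun i _ => Finset.sum_le_sum fun j _ => hterm i j
    _ = ∑ i, (r i * (Real.log N - 1) + r i * (r i * ∑ j, overlap U V i j / p j) / N) := by
        refine Finset.sum_congr rfl fun i _ => ?_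
        rw [Finset.sum_add_distrib, ← Finset.sum_mul, ← Finset.sum_mul, hwr, one_mul,
          ← Finset.sum_div, ← Finset.mul_sum, ← Finset.mul_sum]
    _ ≤ ∑ i, (r i * (Real.log N - 1) + r i * N / N) := by
        gcongr with i _
        · exact hr i
        · exact eigenvalue_mul_sum_div_le hρ hr hV i
    _ = _ := by
        have : ∀ i, r i * (Real.log N - 1) + r i * N / N = r i * Real.log N := by
          intro i
          field_simp
          ring
        simp_rw [this]
        rw [← Finset.sum_mul, hr1, one_mul]

lemma klTerm_ne_bot (p q : ℝ) : klTerm p q ≠ ⊥ := by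
  rw [klTerm]
  split_ifs
  · exact EReal.zero_ne_bot
  · exact top_ne_bot
  · exact EReal.coe_ne_bot _

lemma sum_ne_bot {α : Type*} {t : Finset α} {f : α → EReal} (h : ∀ a ∈ t, f a ≠ ⊥) :
    ∑ a ∈ t, f a ≠ ⊥ := by
  classical
  induction t using Finset.induction_on with
  | empty => simp
  | insert a t ha ih =>
    rw [Finset.sum_insert ha, ne_eq, EReal.add_eq_bot_iff, not_or]
    exact ⟨h a (Finset.mem_insert_self a t), ih fun b hb => h b (Finset.mem_insert_of_mem hb)⟩

lemma sum_eq_top {α : Type*} {t : Finset α} {f : α → EReal} (h : ∀ a ∈ t, f a ≠ ⊥) {a : α}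
    (ha : a ∈ t) (hfa : f a = ⊤) : ∑ a ∈ t, f a = ⊤ := by
  classical
  rw [← Finset.add_sum_erase t f ha, hfa]
  exact EReal.top_add_of_ne_bot (sum_ne_bot fun b hb => h b (Finset.mem_of_mem_erase hb))

/-- The rank-one projective measurement in the basis given by the columns of a unitary. -/
lemma isPOVM_basis {V : Matrix κ κ ℂ} (hV : star V * V = 1) {k : ℕ} (e : Fin k ≃ κ) :
    IsPOVM fun x => V * diagonal (Pi.single (e x) (1 : ℂ)) * star V where
  posSemidef x := by
    rw [star_eq_conjTranspose]
    refine (PosSemidef.diagonal fun i => ?_).mul_mul_conjTranspose_same V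
    by_cases h : i = e x
    · subst h; simp
    · simp [Pi.single_eq_of_ne h]
  sum_eq_one := by
    rw [← Finset.sum_mul, ← Finset.mul_sum,
      Equiv.sum_comp e fun i => diagonal (Pi.single i (1 : ℂ))]
    have : ∑ i : κ, diagonal (Pi.single i (1 : ℂ)) = (1 : Matrix κ κ ℂ) := by
      ext a b
      rw [Matrix.sum_apply]
      by_cases hab : a = b
      · subst hab
        simp [Pi.single_apply]
      · simp [hab]
    rw [this, Matrix.mul_one, mul_eq_one_comm.1 hV]

/-- Measuring in an eigenbasis of σ gives its eigenvalues s as the outcome distribution of σ, and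
the diagonal of V* ρ V as that of ρ. -/
lemma sum_klTerm_basis_le {ρ σ U V : Matrix κ κ ℂ} {r s : κ → ℝ}
    (hρ : IsDiagonalization ρ U r) (hσ : IsDiagonalization σ V s) :
    ∑ j, klTerm (∑ i, overlap U V i j * r i) (s j) ≤ measuredRelEntropy ρ σ := by
  set e := (Fintype.equivFin κ).symm
  have hE := isPOVM_basis hσ.star_mul e
  have h1 : ∀ j : κ, diagonal (Pi.single j (1 : ℂ)) =
      diagonal (fun i => (((Pi.single j (1 : ℝ) : κ → ℝ) i : ℝ) : ℂ)) := by
    intro j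
    congr 1
    ext i
    by_cases h : i = j
    · subst h; simp
    · simp [Pi.single_eq_of_ne h]
  have hov : ∀ i j, overlap V V i j = if i = j then 1 else 0 := by
    intro i j
    rw [overlap, hσ.star_mul, one_apply]
    split_ifs <;> simp
  refine le_trans (le_of_eq ?_) (le_iSup_of_le _ (le_iSup_of_le _ (le_iSup_of_le hE le_rfl)))
  rw [← Equiv.sum_comp e]
  refine Finset.sum_congr rfl fun x _ => ?_
  congr 1
  · rw [h1, hρ.eq, trace_mul_diagonal_mul, Complex.ofReal_re]
    simp [Pi.single_apply]
  · rw [h1, hσ.eq, trace_mul_diagonal_mul, Complex.ofReal_re]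
    simp [Pi.single_apply, hov]

/-- The relative entropy exceeds the measured one by at most the logarithm of the number of
distinct eigenvalues of the second argument. -/
theorem relEntropy_le_measuredRelEntropy_add {ρ σ : Matrix κ κ ℂ} (hρ : ρ ∈ densityMatrices κ)
    (hσ : σ ∈ densityMatrices κ) {N : ℕ}
    (hN : ∀ V s, IsDiagonalization σ V s → (Finset.univ.image s).card ≤ N) :
    relEntropy ρ σ ≤ measuredRelEntropy ρ σ + (Real.log N : ℝ) := by
  have hU := hρ.1.isHermitian.isDiagonalization
  set U : Matrix κ κ ℂ := hρ.1.isHermitian.eigenvectorUnitary.1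
  set r := hρ.1.isHermitian.eigenvalues
  obtain ⟨V, s, hV, hVρ⟩ := exists_isDiagonalization_adapted hρ.1.isHermitian hσ.1.isHermitian
  have hr := hU.nonneg hρ.1
  have hr1 : ∑ i, r i = 1 := by
    have := hU.trace
    rw [hρ.2] at this
    exact_mod_cast this.symm
  set p : κ → ℝ := fun j => ∑ i, overlap U V i j * r i with hp
  have hmeas := sum_klTerm_basis_le hU hV
  by_cases hps : ∀ j, s j = 0 → p j = 0
  · have hsupp : supp ρ ≤ supp σ := by
      rw [supp_le_supp_iff hU hV]
      intro i j hi hj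
      have h1 := (Finset.sum_eq_zero_iff_of_nonneg
        (fun l _ => mul_nonneg (overlap_nonneg U V l j) (hr l))).1 (hps j hj) i (Finset.mem_univ i)
      exact (mul_eq_zero.1 h1).resolve_right hi
    have h2 : ∑ j, klTerm (p j) (s j) =
        ((∑ j, p j * (Real.log (p j) - Real.log (s j)) : ℝ) : EReal) := by
      rw [coe_sum]
      exact Finset.sum_congr rfl fun j _ => klTerm_eq_coe (hps j)
    rw [h2] at hmeas
    refine le_trans ?_ (add_le_add_left hmeas _)
    rw [relEntropy_eq hU hV hsupp, ← EReal.coe_add]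
    refine EReal.coe_le_coe ?_
    have h3 := sum_overlap_log_le hU hr hr1 hV.star_mul hVρ
    have h4 : Real.log (Finset.univ.image s).card ≤ Real.log N := by
      refine Real.log_le_log ?_ (by exact_mod_cast hN V s hV)
      have : Nonempty κ := by
        by_contra hne
        rw [not_nonempty_iff] at hne
        simp at hr1
      rw [Nat.cast_pos, Finset.card_pos]
      exact Finset.univ_nonempty.image s
    have h5 : ∑ i, r i * Real.log (r i) =
        ∑ i, ∑ j, overlap U V i j * r i * Real.log (r i) := by
      refine Finset.sum_congr rfl fun i _ => ?_
      rw [← Finset.sum_mul, ← Finset.sum_mul, sum_overlap_right hU.star_mul hV.star_mul, one_mul]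
    have h6 : ∀ f : κ → ℝ, ∑ j, p j * f j = ∑ i, ∑ j, overlap U V i j * r i * f j := by
      intro f
      rw [Finset.sum_comm]
      refine Finset.sum_congr rfl fun j _ => ?_
      rw [hp, Finset.sum_mul]
    simp only [mul_sub, Finset.sum_sub_distrib] at h3 ⊢
    rw [h6, h6, h5]
    linarith
  -- An outcome that is possible for ρ but not for σ makes the measured relative entropy infinite
  -- already.
  · push Not at hps
    obtain ⟨j, hj, hpj⟩ := hps
    have h7 : ∑ j, klTerm (p j) (s j) = ⊤ :=
      sum_eq_top (fun a _ => klTerm_ne_bot _ _) (Finset.mem_univ j)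
        (by rw [klTerm, if_neg hpj, if_pos hj])
    rw [h7, top_le_iff] at hmeas
    rw [hmeas, EReal.top_add_of_ne_bot (EReal.coe_ne_bot _)]
    exact le_top

end Pinching

/-! ### Convexity and symmetry of the measured relative entropy -/

section Measured

variable {κ : Type*} [Fintype κ] [DecidableEq κ]

lemma sum_klTerm_le_measuredRelEntropy {k : ℕ} {E : Fin k → Matrix κ κ ℂ} (hE : IsPOVM E)
    (ρ σ : Matrix κ κ ℂ) :
    ∑ x, klTerm (ρ * E x).trace.re (σ * E x).trace.re ≤ measuredRelEntropy ρ σ :=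
  le_iSup_of_le k (le_iSup_of_le E (le_iSup_of_le hE le_rfl))

lemma eq_zero_of_sum_klTerm_ne_top {α : Type*} [Fintype α] {p q : α → ℝ}
    (h : ∑ x, klTerm (p x) (q x) ≠ ⊤) (x : α) (hx : q x = 0) : p x = 0 := by
  by_contra hp
  exact h (sum_eq_top (fun a _ => klTerm_ne_bot _ _) (Finset.mem_univ x)
    (by rw [klTerm, if_neg hp, if_pos hx]))

lemma sum_klTerm_eq_coe {α : Type*} [Fintype α] {p q : α → ℝ} (h : ∀ x, q x = 0 → p x = 0) :
    ∑ x, klTerm (p x) (q x) =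
      ((∑ x, p x * (Real.log (p x) - Real.log (q x)) : ℝ) : EReal) := by
  rw [coe_sum]
  exact Finset.sum_congr rfl fun x _ => klTerm_eq_coe (h x)

/-- Concavity of the logarithm. Bounding by a common C, rather than by the convex combination of the
two values, avoids arithmetic with infinities: a real C makes both sums finite. -/
lemma sum_klTerm_convexCombination_le {α : Type*} [Fintype α] {p q q' : α → ℝ}
    (hp : ∀ x, 0 ≤ p x) (hq : ∀ x, 0 ≤ q x) (hq' : ∀ x, 0 ≤ q' x) {a b : ℝ} (ha : 0 ≤ a)
    (hb : 0 ≤ b) (hab : a + b = 1) {C : EReal} (h : ∑ x, klTerm (p x) (q x) ≤ C)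
    (h' : ∑ x, klTerm (p x) (q' x) ≤ C) :
    ∑ x, klTerm (p x) (a * q x + b * q' x) ≤ C := by
  induction C with
  | bot =>
    exact absurd (le_bot_iff.1 h) (sum_ne_bot fun x _ => klTerm_ne_bot _ _)
  | top => exact le_top
  | coe c =>
    have h1 := eq_zero_of_sum_klTerm_ne_top (ne_top_of_le_ne_top (EReal.coe_ne_top c) h)
    have h2 := eq_zero_of_sum_klTerm_ne_top (ne_top_of_le_ne_top (EReal.coe_ne_top c) h')
    have h3 : ∀ x, a * q x + b * q' x = 0 → p x = 0 := by
      intro x hx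
      have hax := mul_nonneg ha (hq x)
      have hbx := mul_nonneg hb (hq' x)
      have h4 : a * q x = 0 := by linarith
      have h5 : b * q' x = 0 := by linarith
      rcases mul_eq_zero.1 h4 with h6 | h6
      · rcases mul_eq_zero.1 h5 with h7 | h7
        · rw [h6, h7] at hab
          norm_num at hab
        · exact h2 x h7
      · exact h1 x h6
    rw [sum_klTerm_eq_coe h1, EReal.coe_le_coe_iff] at h
    rw [sum_klTerm_eq_coe h2, EReal.coe_le_coe_iff] at h'
    rw [sum_klTerm_eq_coe h3, EReal.coe_le_coe_iff]
    have h8 : ∀ x, p x * (Real.log (p x) - Real.log (a * q x + b * q' x)) ≤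
        a * (p x * (Real.log (p x) - Real.log (q x))) +
          b * (p x * (Real.log (p x) - Real.log (q' x))) := by
      intro x
      rcases (hp x).eq_or_lt with h0 | h0
      · simp [← h0]
      have hqx : 0 < q x := lt_of_le_of_ne (hq x) fun h => h0.ne' (h1 x h.symm)
      have hqx' : 0 < q' x := lt_of_le_of_ne (hq' x) fun h => h0.ne' (h2 x h.symm)
      have hlog := strictConcaveOn_log_Ioi.concaveOn.2 hqx hqx' ha hb hab
      simp only [smul_eq_mul] at hlog
      have := mul_le_mul_of_nonneg_left hlog h0.le
      have hb' : b = 1 - a := by linarith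
      subst hb'
      nlinarith
    calc _ ≤ ∑ x, (a * (p x * (Real.log (p x) - Real.log (q x))) +
          b * (p x * (Real.log (p x) - Real.log (q' x)))) := Finset.sum_le_sum fun x _ => h8 x
      _ ≤ a * c + b * c := by
          rw [Finset.sum_add_distrib, ← Finset.mul_sum, ← Finset.mul_sum]
          gcongr
      _ = c := by rw [← add_mul, hab, one_mul]

lemma convex_measuredRelEntropy_le {ρ : Matrix κ κ ℂ} (hρ : ρ.PosSemidef) (C : EReal) :
    Convex ℝ {σ : Matrix κ κ ℂ | σ.PosSemidef ∧ measuredRelEntropy ρ σ ≤ C} := by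
  rintro σ ⟨hσ, h⟩ σ' ⟨hσ', h'⟩ a b ha hb hab
  refine ⟨(hσ.smul ha).add (hσ'.smul hb), iSup_le fun k => iSup_le fun E => iSup_le fun hE => ?_⟩
  have hle : ∀ {τ}, measuredRelEntropy ρ τ ≤ C →
      ∑ x, klTerm (ρ * E x).trace.re (τ * E x).trace.re ≤ C := fun {τ} hτ =>
    (sum_klTerm_le_measuredRelEntropy hE ρ τ).trans hτ
  have := sum_klTerm_convexCombination_le
    (fun x => trace_mul_re_nonneg hρ (hE.posSemidef x))
    (fun x => trace_mul_re_nonneg hσ (hE.posSemidef x))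
    (fun x => trace_mul_re_nonneg hσ' (hE.posSemidef x)) ha hb hab (hle h) (hle h')
  refine le_trans (le_of_eq (Finset.sum_congr rfl fun x _ => ?_)) this
  congr 1
  rw [Matrix.add_mul, trace_add, Complex.add_re, Matrix.smul_mul, Matrix.smul_mul, trace_smul,
    trace_smul, Complex.smul_re, Complex.smul_re, smul_eq_mul, smul_eq_mul]

/-- By cyclicity of the trace, P can be moved onto the POVM, and conjugating a POVM by a unitary
gives a POVM. -/
lemma measuredRelEntropy_conj_le {ρ σ P : Matrix κ κ ℂ} (hP : P.conjTranspose * P = 1)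
    (hρ : P * ρ * P.conjTranspose = ρ) :
    measuredRelEntropy ρ (P * σ * P.conjTranspose) ≤ measuredRelEntropy ρ σ := by
  refine iSup_le fun k => iSup_le fun E => iSup_le fun hE => ?_
  have hF : IsPOVM fun x => P.conjTranspose * E x * P :=
    ⟨fun x => (hE.posSemidef x).conjTranspose_mul_mul_same P, by
      rw [← Finset.sum_mul, ← Finset.mul_sum, hE.sum_eq_one, Matrix.mul_one, hP]⟩
  refine le_trans (le_of_eq ?_) (sum_klTerm_le_measuredRelEntropy hF ρ σ)
  have htr : ∀ (τ X : Matrix κ κ ℂ), (P * τ * P.conjTranspose * X).trace =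
      (τ * (P.conjTranspose * X * P)).trace := by
    intro τ X
    simp only [Matrix.mul_assoc]
    rw [Matrix.trace_mul_comm P]
    simp only [Matrix.mul_assoc]
  refine Finset.sum_congr rfl fun x _ => ?_
  rw [← htr, ← htr, hρ]

end Measured

/-! ### Permutation-invariant matrices have few eigenvalues -/

section Permutation

variable {ι : Type*} [Fintype ι] [DecidableEq ι] {n : ℕ}

lemma permUnitary_mul_mul_apply (π : Equiv.Perm (Fin n))
    (X : Matrix (Fin n → ι) (Fin n → ι) ℂ) (i j : Fin n → ι) :
    (permUnitary (ι := ι) π * X * (permUnitary (ι := ι) π).conjTranspose) i j =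
      X (i ∘ π) (j ∘ π) := by
  have h : ∀ i a : Fin n → ι, permUnitary π i a = if a = i ∘ π then 1 else 0 := by
    intro i a
    rw [permUnitary, of_apply]
    congr 1
    rw [eq_iff_iff]
    constructor
    · rintro rfl
      ext l
      simp
    · rintro rfl
      ext l
      simp
  rw [Matrix.mul_apply, Finset.sum_eq_single (j ∘ π)]
  · rw [conjTranspose_apply, h, if_pos rfl, star_one, mul_one, Matrix.mul_apply,
      Finset.sum_eq_single (i ∘ π)]
    · rw [h, if_pos rfl, one_mul]
    · intro b _ hb
      rw [h, if_neg hb, zero_mul]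
    · simp
  · intro b _ hb
    rw [conjTranspose_apply, h, if_neg hb, star_zero, mul_zero]
  · simp

lemma conjTranspose_permUnitary_mul (π : Equiv.Perm (Fin n)) :
    (permUnitary (ι := ι) π).conjTranspose * permUnitary π = 1 := by
  rw [mul_eq_one_comm]
  ext i j
  have h := permUnitary_mul_mul_apply π (1 : Matrix (Fin n → ι) (Fin n → ι) ℂ) i j
  rw [Matrix.mul_one] at h
  rw [h, one_apply, one_apply]
  congr 1
  rw [eq_iff_iff]
  exact π.surjective.injective_comp_right.eq_iff

lemma permUnitary_conj_tensorPow (ρ : Matrix ι ι ℂ) (π : Equiv.Perm (Fin n)) :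
    permUnitary (ι := ι) π * tensorPow ρ n * (permUnitary (ι := ι) π).conjTranspose =
      tensorPow ρ n := by
  ext i j
  rw [permUnitary_mul_mul_apply]
  exact Equiv.prod_comp π fun l => ρ (i l) (j l)

/-- The matrices that commute with permutations of the tensor factors. -/
def permInvariant (ι : Type*) [Fintype ι] [DecidableEq ι] (n : ℕ) :
    Subalgebra ℝ (Matrix (Fin n → ι) (Fin n → ι) ℂ) where
  carrier := {X | ∀ (π : Equiv.Perm (Fin n)) (i j : Fin n → ι), X (i ∘ π) (j ∘ π) = X i j}
  mul_mem' := by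
    intro X Y hX hY π i j
    rw [Matrix.mul_apply, Matrix.mul_apply,
      ← Equiv.sum_comp (Equiv.arrowCongr π.symm (Equiv.refl ι))]
    refine Finset.sum_congr rfl fun a _ => ?_
    have : Equiv.arrowCongr π.symm (Equiv.refl ι) a = a ∘ π := by
      ext l
      simp [Equiv.arrowCongr]
    rw [this, hX, hY]
  add_mem' := by
    intro X Y hX hY π i j
    rw [Matrix.add_apply, Matrix.add_apply, hX, hY]
  algebraMap_mem' := by
    intro c π i j
    rw [algebraMap_matrix_apply, algebraMap_matrix_apply]
    congr 1
    rw [eq_iff_iff]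
    exact π.surjective.injective_comp_right.eq_iff

/-- The number of occurrences of each value. -/
def occurrences {α : Type*} [DecidableEq α] (u : Fin n → α) (c : α) : Fin (n + 1) :=
  ⟨(Finset.univ.filter fun l => u l = c).card,
    Nat.lt_succ_of_le ((Finset.card_le_univ _).trans_eq (Fintype.card_fin n))⟩

lemma exists_perm_of_occurrences_eq {α : Type*} [DecidableEq α] {u v : Fin n → α}
    (h : occurrences u = occurrences v) : ∃ π : Equiv.Perm (Fin n), u = v ∘ π := by
  have hc : ∀ c, Fintype.card {a // u a = c} = Fintype.card {b // v b = c} := by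
    intro c
    rw [Fintype.card_subtype, Fintype.card_subtype]
    exact congrArg Fin.val (congrFun h c)
  refine ⟨Equiv.ofFiberEquiv fun c => Fintype.equivOfCardEq (hc c), ?_⟩
  ext a
  exact (Equiv.ofFiberEquiv_map _ a).symm

/-- An invariant entry X i j depends only on how often each pair in ι × ι occurs among the (i l, j
l). There are at most (n+1)^(d²) such counts, and the factor 2 is the real dimension of ℂ. -/
lemma finrank_permInvariant_le :
    Module.finrank ℝ (permInvariant ι n) ≤ 2 * (n + 1) ^ (Fintype.card ι ^ 2) := by
  let Φ : ((ι × ι → Fin (n + 1)) → ℂ) →ₗ[ℝ] Matrix (Fin n → ι) (Fin n → ι) ℂ :=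
    { toFun := fun f => Matrix.of fun i j => f (occurrences fun l => (i l, j l))
      map_add' := fun f g => rfl
      map_smul' := fun c f => rfl }
  have hle : Subalgebra.toSubmodule (permInvariant ι n) ≤ LinearMap.range Φ := by
    intro X hX
    let o : (Fin n → ι) × (Fin n → ι) → (ι × ι → Fin (n + 1)) :=
      fun a => occurrences fun l => (a.1 l, a.2 l)
    have hfac : Function.FactorsThrough (fun a : (Fin n → ι) × (Fin n → ι) => X a.1 a.2) o := by
      intro a b hab
      obtain ⟨π, hπ⟩ := exists_perm_of_occurrences_eq hab
      have h1 : a.1 = b.1 ∘ π := funext fun l => congrArg Prod.fst (congrFun hπ l)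
      have h2 : a.2 = b.2 ∘ π := funext fun l => congrArg Prod.snd (congrFun hπ l)
      change X a.1 a.2 = X b.1 b.2
      rw [h1, h2]
      exact hX π _ _
    refine ⟨Function.extend o (fun a => X a.1 a.2) 0, ?_⟩
    ext i j
    exact hfac.extend_apply 0 (i, j)
  calc Module.finrank ℝ (permInvariant ι n)
      = Module.finrank ℝ (Subalgebra.toSubmodule (permInvariant ι n)) := rfl
    _ ≤ Module.finrank ℝ (LinearMap.range Φ) := Submodule.finrank_mono hle
    _ ≤ Module.finrank ℝ ((ι × ι → Fin (n + 1)) → ℂ) := LinearMap.finrank_range_le Φ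
    _ = _ := by
      rw [Module.finrank_pi_fintype]
      simp [Complex.finrank_real_complex, pow_two, mul_comm]

/-- A permutation-invariant matrix has only polynomially many distinct eigenvalues. -/
lemma card_eigenvalues_le_of_mem_permInvariant {σ V : Matrix (Fin n → ι) (Fin n → ι) ℂ}
    {s : (Fin n → ι) → ℝ} (hσ : σ ∈ permInvariant ι n) (hV : IsDiagonalization σ V s) :
    (Finset.univ.image s).card ≤ 2 * (n + 1) ^ (Fintype.card ι ^ 2) := by
  -- Inside the invariant algebra the minimal polynomial has degree at most the dimension of that
  -- algebra, instead of the exponential size of the matrices; all eigenvalues are roots of it.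
  set x : permInvariant ι n := ⟨σ, hσ⟩
  have hint : IsIntegral ℝ x := IsIntegral.of_finite ℝ x
  have h0 : Polynomial.aeval σ (minpoly ℝ x) = 0 := by
    have h1 := minpoly.aeval ℝ x
    have h2 := congrArg Subtype.val h1
    rwa [← Subalgebra.coe_val, ← Polynomial.aeval_algHom_apply] at h2
  have hroot : ∀ i, (minpoly ℝ x).eval (s i) = 0 := by
    intro i
    rw [hV.aeval] at h0
    have h1 : diagonal (fun i => (((minpoly ℝ x).eval (s i) : ℝ) : ℂ)) = 0 := by
      have h2 : star V * (V * diagonal (fun i => (((minpoly ℝ x).eval (s i) : ℝ) : ℂ)) * star V) *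
          V = (star V * V) * diagonal (fun i => (((minpoly ℝ x).eval (s i) : ℝ) : ℂ)) *
            (star V * V) := by simp only [Matrix.mul_assoc]
      rw [h0, hV.star_mul, Matrix.mul_one, Matrix.one_mul, Matrix.mul_zero, Matrix.zero_mul] at h2
      exact h2.symm
    have h2 := congrFun (congrFun h1 i) i
    rw [diagonal_apply_eq, Matrix.zero_apply] at h2
    exact_mod_cast h2
  have hsub : Finset.univ.image s ⊆ (minpoly ℝ x).roots.toFinset := by
    intro a ha
    obtain ⟨i, -, rfl⟩ := Finset.mem_image.1 ha
    rw [Multiset.mem_toFinset, Polynomial.mem_roots (minpoly.ne_zero hint)]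
    exact hroot i
  calc (Finset.univ.image s).card ≤ (minpoly ℝ x).roots.toFinset.card := Finset.card_le_card hsub
    _ ≤ (minpoly ℝ x).roots.card := Multiset.toFinset_card_le _
    _ ≤ (minpoly ℝ x).natDegree := Polynomial.card_roots' _
    _ ≤ Module.finrank ℝ (permInvariant ι n) := minpoly.natDegree_le x
    _ ≤ _ := finrank_permInvariant_le

/-- A convex permutation-closed set meets the permutation-invariant matrices. -/
lemma exists_mem_permInvariant {S : Set (Matrix (Fin n → ι) (Fin n → ι) ℂ)} (hS : Convex ℝ S)
    (hperm : ∀ σ ∈ S, ∀ π : Equiv.Perm (Fin n),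
      permUnitary (ι := ι) π * σ * (permUnitary (ι := ι) π).conjTranspose ∈ S) (hne : S.Nonempty) :
    ∃ σ ∈ S, σ ∈ permInvariant ι n := by
  obtain ⟨σ, hσ⟩ := hne
  -- The average over all permutations, which reindexing by τ⁻¹ shows to be invariant under τ.
  refine ⟨∑ π : Equiv.Perm (Fin n), ((Fintype.card (Equiv.Perm (Fin n)) : ℝ)⁻¹) •
    (permUnitary (ι := ι) π * σ * (permUnitary (ι := ι) π).conjTranspose),
    hS.sum_mem (fun _ _ => by positivity) ?_ fun π _ => hperm σ hσ π, ?_⟩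
  · simp [Finset.sum_const, Finset.card_univ]
  · intro τ i j
    rw [Matrix.sum_apply, Matrix.sum_apply, ← Equiv.sum_comp (Equiv.mulLeft τ⁻¹)]
    refine Finset.sum_congr rfl fun π _ => ?_
    rw [Matrix.smul_apply, Matrix.smul_apply, permUnitary_mul_mul_apply,
      permUnitary_mul_mul_apply]
    congr 2 <;>
    · ext l
      simp

end Permutation

/-! ### Compactness and lower semicontinuity -/

section Semicontinuity

variable {κ : Type*} [Fintype κ] [DecidableEq κ]

lemma IsDiagonalization.sum_eq_one {σ V : Matrix κ κ ℂ} {s : κ → ℝ}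
    (hV : IsDiagonalization σ V s) (hσ : σ ∈ densityMatrices κ) : ∑ i, s i = 1 := by
  have := hV.trace
  rw [hσ.2] at this
  exact_mod_cast this.symm

lemma IsDiagonalization.le_one {σ V : Matrix κ κ ℂ} {s : κ → ℝ}
    (hV : IsDiagonalization σ V s) (hσ : σ ∈ densityMatrices κ) (i : κ) : s i ≤ 1 :=
  (Finset.single_le_sum (fun j _ => hV.nonneg hσ.1 j) (Finset.mem_univ i)).trans_eq
    (hV.sum_eq_one hσ)

lemma norm_apply_le_one {σ : Matrix κ κ ℂ} (hσ : σ ∈ densityMatrices κ) (i j : κ) :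
    ‖σ i j‖ ≤ 1 := by
  have hV := hσ.1.isHermitian.isDiagonalization
  set V : Matrix κ κ ℂ := hσ.1.isHermitian.eigenvectorUnitary.1 with hVdef
  set s := hσ.1.isHermitian.eigenvalues
  have hle : ∀ a b, ‖V a b‖ ≤ 1 :=
    entry_norm_bound_of_unitary hσ.1.isHermitian.eigenvectorUnitary.2
  have h1 : σ i j = ∑ k, V i k * s k * star (V j k) := by
    nth_rw 1 [hV.eq]
    rw [Matrix.mul_apply]
    refine Finset.sum_congr rfl fun k _ => ?_
    rw [mul_diagonal, star_apply]
  rw [h1, ← hV.sum_eq_one hσ]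
  refine (norm_sum_le _ _).trans (Finset.sum_le_sum fun k _ => ?_)
  rw [norm_mul, norm_mul, norm_star, Complex.norm_real, Real.norm_of_nonneg (hV.nonneg hσ.1 k)]
  calc ‖V i k‖ * s k * ‖V j k‖ ≤ 1 * s k * 1 := by
        gcongr
        · exact mul_nonneg zero_le_one (hV.nonneg hσ.1 k)
        · exact hV.nonneg hσ.1 k
        · exact hle _ _
        · exact hle _ _
    _ = s k := by ring

lemma isCompact_of_subset_densityMatrices {κ : Type*} [Fintype κ] {S : Set (Matrix κ κ ℂ)}
    (hS : S ⊆ densityMatrices κ) (hc : IsClosed S) : IsCompact S := by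
  classical
  have hK : IsCompact (Set.univ.pi fun _ : κ => Set.univ.pi fun _ : κ =>
      Metric.closedBall (0 : ℂ) 1) :=
    isCompact_univ_pi fun _ => isCompact_univ_pi fun _ => isCompact_closedBall _ _
  refine hK.of_isClosed_subset hc fun σ hσ i _ j _ => ?_
  rw [mem_closedBall_zero_iff]
  exact norm_apply_le_one (hS hσ) i j

/-- Continuity extends to q = 0 because −p log q → +∞ for p > 0, which is the value assigned there.
-/
lemma continuousOn_klTerm {p : ℝ} (hp0 : 0 ≤ p) : ContinuousOn (klTerm p) (Set.Ici 0) := by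
  by_cases hp : p = 0
  · have : klTerm p = fun _ => 0 := by
      ext q
      rw [klTerm, if_pos hp]
    rw [this]
    exact continuousOn_const
  have h1 : ∀ q, q ≠ 0 → klTerm p q = ((p * (Real.log p - Real.log q) : ℝ) : EReal) :=
    fun q hq => klTerm_eq_coe fun h => absurd h hq
  intro q hq
  rcases (Set.mem_Ici.1 hq).eq_or_lt with h0 | h0
  · subst h0
    rw [← Set.Ioi_insert, continuousWithinAt_insert_self]
    have h2 : klTerm p 0 = ⊤ := by rw [klTerm, if_neg hp, if_pos rfl]
    have h3 : Tendsto (fun q => ((p * (Real.log p - Real.log q) : ℝ) : EReal)) (𝓝[>] 0)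
        (𝓝 ⊤) := by
      rw [EReal.tendsto_coe_nhds_top_iff]
      refine Tendsto.const_mul_atTop (lt_of_le_of_ne hp0 (Ne.symm hp)) ?_
      exact tendsto_atTop_add_const_left _ _
        (tendsto_neg_atBot_atTop.comp Real.tendsto_log_nhdsGT_zero)
    rw [ContinuousWithinAt, h2]
    refine h3.congr' ?_
    filter_upwards [self_mem_nhdsWithin] with q hq using (h1 q (ne_of_gt hq)).symm
  · have h3 : ContinuousAt (fun q => ((p * (Real.log p - Real.log q) : ℝ) : EReal)) q :=
      continuous_coe_real_ereal.continuousAt.comp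
        ((continuousAt_const.sub (Real.continuousAt_log h0.ne')).const_mul p)
    refine (h3.congr ?_).continuousWithinAt
    filter_upwards [eventually_ne_nhds h0.ne'] with q' hq' using (h1 q' hq').symm

/-- Extended real addition is discontinuous only at sums of opposite infinities, excluded by `hbot`.
-/
lemma continuousOn_sum_ereal {X α : Type*} [TopologicalSpace X] {S : Set X} {t : Finset α}
    {f : α → X → EReal} (hf : ∀ a ∈ t, ContinuousOn (f a) S) (hbot : ∀ a x, f a x ≠ ⊥) :
    ContinuousOn (fun x => ∑ a ∈ t, f a x) S := by
  classical
  induction t using Finset.induction_on with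
  | empty => simpa using continuousOn_const
  | insert a t ha ih =>
    simp_rw [Finset.sum_insert ha]
    intro x hx
    have h1 := ih (fun b hb => hf b (Finset.mem_insert_of_mem hb)) x hx
    have h2 := hf a (Finset.mem_insert_self a t) x hx
    exact ContinuousAt.comp_continuousWithinAt (g := fun p : EReal × EReal => p.1 + p.2)
      (f := fun x => (f a x, ∑ b ∈ t, f b x))
      (EReal.continuousAt_add (Or.inr (sum_ne_bot fun b _ => hbot b x)) (Or.inl (hbot a x)))
      (h2.prodMk h1)

lemma lowerSemicontinuousOn_measuredRelEntropy {ρ : Matrix κ κ ℂ} (hρ : ρ.PosSemidef) :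
    LowerSemicontinuousOn (measuredRelEntropy ρ) {σ | σ.PosSemidef} := by
  refine lowerSemicontinuousOn_iSup fun k => lowerSemicontinuousOn_iSup fun E =>
    lowerSemicontinuousOn_iSup fun hE => ContinuousOn.lowerSemicontinuousOn ?_
  refine continuousOn_sum_ereal (fun x _ => ?_) fun x σ => klTerm_ne_bot _ _
  have h : Continuous fun σ : Matrix κ κ ℂ => (σ * E x).trace.re := by fun_prop
  exact (continuousOn_klTerm (trace_mul_re_nonneg hρ (hE.posSemidef x))).comp h.continuousOn
    fun σ hσ => trace_mul_re_nonneg hσ (hE.posSemidef x)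

/-- Relative entropy with regularised second argument. -/
noncomputable def regularizedRelEntropy (ρ σ : Matrix κ κ ℂ) (ε : ℝ) : ℝ :=
  (ρ * cfc Real.log ρ).trace.re - (ρ * cfc (fun x => Real.log (x + ε)) σ).trace.re

lemma continuousOn_regularizedRelEntropy (ρ : Matrix κ κ ℂ) {ε : ℝ} (hε : 0 < ε) :
    ContinuousOn (fun σ => regularizedRelEntropy ρ σ ε) (densityMatrices κ) := by
  have hf : ContinuousOn (fun x => Real.log (x + ε)) (Set.Icc 0 1) := by
    refine ContinuousOn.log (by fun_prop) fun x hx => ?_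
    have := hx.1
    positivity
  have h : ContinuousOn (cfc (fun x => Real.log (x + ε)) : Matrix κ κ ℂ → Matrix κ κ ℂ)
      {σ | IsSelfAdjoint σ ∧ spectrum ℝ σ ⊆ Set.Icc 0 1} := by
    open scoped Matrix.Norms.L2Operator in
    exact continuousOn_cfc (Matrix κ κ ℂ) isCompact_Icc _ hf
  have h2 : Continuous (fun X : Matrix κ κ ℂ => (ρ * X).trace.re) := by fun_prop
  refine continuousOn_const.sub (h2.comp_continuousOn (h.mono fun σ hσ => ⟨hσ.1.isHermitian, ?_⟩))
  rw [hσ.1.isHermitian.spectrum_real_eq_range_eigenvalues]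
  rintro _ ⟨i, rfl⟩
  have hV := hσ.1.isHermitian.isDiagonalization
  exact ⟨hV.nonneg hσ.1 i, hV.le_one hσ i⟩

/-- The term a₀ contributes −c log ε → +∞; the remaining logarithms are bounded above by their
values at ε = 1. -/
lemma tendsto_neg_sum_mul_log_top {α : Type*} [Fintype α] {c s : α → ℝ} (hc : ∀ a, 0 ≤ c a)
    (hs : ∀ a, 0 ≤ s a) {a₀ : α} (ha₀ : s a₀ = 0) (hca₀ : c a₀ ≠ 0) (b : ℝ) :
    Tendsto (fun ε => b - ∑ a, c a * Real.log (s a + ε)) (𝓝[>] 0) atTop := by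
  classical
  have h1 : Tendsto (fun ε => b - (c a₀ * Real.log ε +
      ∑ a ∈ Finset.univ.erase a₀, c a * Real.log (s a + 1))) (𝓝[>] 0) atTop := by
    refine tendsto_atTop_add_const_left _ _ (tendsto_neg_atBot_atTop.comp ?_)
    exact tendsto_atBot_add_const_right _ _
      (Real.tendsto_log_nhdsGT_zero.const_mul_atBot (lt_of_le_of_ne (hc a₀) hca₀.symm))
  refine tendsto_atTop_mono' _ ?_ h1
  filter_upwards [Ioc_mem_nhdsGT (zero_lt_one (α := ℝ))] with ε hε
  rw [← Finset.add_sum_erase _ _ (Finset.mem_univ a₀), ha₀, zero_add]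
  have h2 : ∑ a ∈ Finset.univ.erase a₀, c a * Real.log (s a + ε) ≤
      ∑ a ∈ Finset.univ.erase a₀, c a * Real.log (s a + 1) := by
    refine Finset.sum_le_sum fun a _ => mul_le_mul_of_nonneg_left ?_ (hc a)
    exact Real.log_le_log (add_pos_of_nonneg_of_pos (hs a) hε.1) (by linarith [hε.2])
  linarith

/-- The regularized values increase as ε decreases to 0, so their supremum is their limit, which is
+∞ exactly when the support condition fails. This exhibits D as a supremum of functions continuous
in σ. -/
lemma relEntropy_eq_iSup {ρ σ : Matrix κ κ ℂ} (hρ : ρ.PosSemidef) (hσ : σ.PosSemidef) :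
    relEntropy ρ σ = ⨆ ε : Set.Ioi (0 : ℝ), (regularizedRelEntropy ρ σ ε : EReal) := by
  have hU := hρ.isHermitian.isDiagonalization
  have hV := hσ.isHermitian.isDiagonalization
  set U : Matrix κ κ ℂ := hρ.isHermitian.eigenvectorUnitary.1
  set V : Matrix κ κ ℂ := hσ.isHermitian.eigenvectorUnitary.1
  set r := hρ.isHermitian.eigenvalues
  set s := hσ.isHermitian.eigenvalues
  have hr := hU.nonneg hρ
  have hs := hV.nonneg hσ
  have hreg : ∀ ε, regularizedRelEntropy ρ σ ε = ∑ i, r i * Real.log (r i) -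
      ∑ a : κ × κ, overlap U V a.1 a.2 * r a.1 * Real.log (s a.2 + ε) := by
    intro ε
    rw [regularizedRelEntropy, hU.trace_mul_cfc_self, hU.trace_mul_cfc hV, Fintype.sum_prod_type]
  have hc : ∀ a : κ × κ, 0 ≤ overlap U V a.1 a.2 * r a.1 :=
    fun a => mul_nonneg (overlap_nonneg _ _ _ _) (hr a.1)
  by_cases hsupp : supp ρ ≤ supp σ
  · have hw := (supp_le_supp_iff hU hV).1 hsupp
    have hc0 : ∀ a : κ × κ, s a.2 = 0 → overlap U V a.1 a.2 * r a.1 = 0 := by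
      intro a ha
      by_cases h0 : r a.1 = 0
      · rw [h0, mul_zero]
      · rw [hw a.1 a.2 h0 ha, zero_mul]
    rw [relEntropy_eq hU hV hsupp, ← Fintype.sum_prod_type
      (f := fun a : κ × κ => overlap U V a.1 a.2 * r a.1 * Real.log (s a.2))]
    refine le_antisymm ?_ (iSup_le fun ε => EReal.coe_le_coe ?_)
    · have h1 : Tendsto (fun ε => ((regularizedRelEntropy ρ σ ε : ℝ) : EReal)) (𝓝[>] 0)
          (𝓝 ((∑ i, r i * Real.log (r i) -
            ∑ a : κ × κ, overlap U V a.1 a.2 * r a.1 * Real.log (s a.2) : ℝ) : EReal)) := by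
        refine EReal.tendsto_coe.2 ?_
        rw [funext hreg]
        refine tendsto_const_nhds.sub ?_
        simpa using tendsto_sum_mul_log_zero (t := fun _ => 1) hc0
      refine le_of_tendsto h1 ?_
      filter_upwards [self_mem_nhdsWithin] with ε hε
      exact le_iSup (fun ε : Set.Ioi (0 : ℝ) => (regularizedRelEntropy ρ σ ε : EReal)) ⟨ε, hε⟩
    · rw [hreg]
      refine sub_le_sub_left (Finset.sum_le_sum fun a _ => ?_) _
      rcases (hs a.2).eq_or_lt with h0 | h0
      · rw [hc0 a h0.symm, zero_mul, zero_mul]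
      · have hε : (0 : ℝ) < ε := ε.2
        exact mul_le_mul_of_nonneg_left (Real.log_le_log h0 (by linarith)) (hc a)
  · rw [relEntropy, if_neg hsupp]
    rw [supp_le_supp_iff hU hV] at hsupp
    push Not at hsupp
    obtain ⟨i, j, hi, hj, hij⟩ := hsupp
    refine le_antisymm ?_ le_top
    have h1 : Tendsto (fun ε => ((regularizedRelEntropy ρ σ ε : ℝ) : EReal)) (𝓝[>] 0) (𝓝 ⊤) := by
      rw [EReal.tendsto_coe_nhds_top_iff]
      rw [funext hreg]
      exact tendsto_neg_sum_mul_log_top (a₀ := (i, j)) hc (fun a => hs a.2) hj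
        (mul_ne_zero hij hi) _
    refine le_of_tendsto h1 ?_
    filter_upwards [self_mem_nhdsWithin] with ε hε
    exact le_iSup (fun ε : Set.Ioi (0 : ℝ) => (regularizedRelEntropy ρ σ ε : EReal)) ⟨ε, hε⟩

lemma lowerSemicontinuousOn_relEntropy {ρ : Matrix κ κ ℂ} (hρ : ρ.PosSemidef) :
    LowerSemicontinuousOn (relEntropy ρ) (densityMatrices κ) := by
  have h : LowerSemicontinuousOn
      (fun σ => ⨆ ε : Set.Ioi (0 : ℝ), (regularizedRelEntropy ρ σ ε : EReal))
      (densityMatrices κ) :=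
    lowerSemicontinuousOn_iSup fun ε => ContinuousOn.lowerSemicontinuousOn
      (continuous_coe_real_ereal.comp_continuousOn (continuousOn_regularizedRelEntropy ρ ε.2))
  intro σ hσ y hy
  rw [relEntropy_eq_iSup hρ hσ.1] at hy
  filter_upwards [h σ hσ y hy, self_mem_nhdsWithin] with τ hτ hτ'
  rwa [relEntropy_eq_iSup hρ hτ'.1]

lemma exists_eq_iInf {X : Type*} [TopologicalSpace X] {S : Set X} {f : X → EReal}
    (hS : IsCompact S) (hne : S.Nonempty) (hf : LowerSemicontinuousOn f S) :
    ∃ x ∈ S, f x = ⨅ y ∈ S, f y := by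
  obtain ⟨x, hx, hmin⟩ := hf.exists_isMinOn hne hS
  exact ⟨x, hx, le_antisymm (le_iInf₂ fun y hy => hmin hy) (iInf₂_le x hx)⟩

end Semicontinuity

/-! ### Upper and lower limits of sequences at vanishing distance -/

section Limits

lemma liminf_eq_and_limsup_eq {u v : ℕ → EReal} {c : ℕ → ℝ} (hc : Tendsto c atTop (𝓝 0))
    (huv : ∀ᶠ n in atTop, u n ≤ v n) (hvu : ∀ᶠ n in atTop, v n ≤ u n + c n) :
    liminf u atTop = liminf v atTop ∧ limsup u atTop = limsup v atTop := by
  have hc' : Tendsto (fun n => (c n : EReal)) atTop (𝓝 0) := by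
    rw [← EReal.coe_zero]
    exact EReal.tendsto_coe.2 hc
  have hsup : limsup (fun n => (c n : EReal)) atTop = 0 := hc'.limsup_eq
  constructor
  · refine le_antisymm (liminf_le_liminf huv) ((liminf_le_liminf hvu).trans ?_)
    have h := EReal.liminf_add_le (u := fun n => (c n : EReal)) (v := u) (f := atTop)
      (Or.inl (by rw [hsup]; exact EReal.zero_ne_bot))
      (Or.inl (by rw [hsup]; exact EReal.zero_ne_top))
    rw [hsup, zero_add, add_comm] at h
    exact h
  · refine le_antisymm (limsup_le_limsup huv) ((limsup_le_limsup hvu).trans ?_)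
    have h := EReal.limsup_add_le (u := fun n => (c n : EReal)) (v := u) (f := atTop)
      (Or.inl (by rw [hsup]; exact EReal.zero_ne_bot))
      (Or.inl (by rw [hsup]; exact EReal.zero_ne_top))
    rw [hsup, zero_add, add_comm] at h
    exact h

lemma tendsto_iff_of_liminf_eq_of_limsup_eq {u v : ℕ → EReal}
    (hinf : liminf u atTop = liminf v atTop) (hsup : limsup u atTop = limsup v atTop)
    (L : EReal) : Tendsto u atTop (𝓝 L) ↔ Tendsto v atTop (𝓝 L) := by
  constructor
  · intro h
    exact tendsto_of_liminf_eq_limsup (hinf ▸ h.liminf_eq) (hsup ▸ h.limsup_eq)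
  · intro h
    exact tendsto_of_liminf_eq_limsup (hinf.symm ▸ h.liminf_eq) (hsup.symm ▸ h.limsup_eq)

lemma tendsto_log_polynomial_div (d : ℕ) :
    Tendsto (fun n : ℕ => 1 / (n : ℝ) * Real.log ((2 * (n + 1) ^ d : ℕ) : ℝ)) atTop (𝓝 0) := by
  have h1 : Tendsto (fun n : ℕ => Real.log 2 / (n : ℝ)) atTop (𝓝 0) :=
    tendsto_const_div_atTop_nhds_zero_nat _
  -- The denominator 1 · (n + 1) − 1 is n, so this is log(n + 1)/n → 0.
  have h2 : Tendsto (fun n : ℕ => Real.log ((n : ℝ) + 1) ^ 1 / (1 * ((n : ℝ) + 1) + -1))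
      atTop (𝓝 0) :=
    (Real.tendsto_pow_log_div_mul_add_atTop 1 (-1) 1 one_ne_zero).comp
      (tendsto_atTop_add_const_right _ 1 tendsto_natCast_atTop_atTop)
  have h3 := h1.add (h2.const_mul (d : ℝ))
  rw [mul_zero, add_zero] at h3
  refine h3.congr fun n => ?_
  push_cast
  have : (n : ℝ) + 1 ≠ 0 := by positivity
  rw [Real.log_mul two_ne_zero (pow_ne_zero _ this), Real.log_pow]
  have h4 : 1 * ((n : ℝ) + 1) + -1 = n := by ring
  rw [h4]
  ring

end Limits

/-! ### Tensor powers and comparison of the two resource measures -/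

section Resource

variable {ι : Type*} [Fintype ι] [DecidableEq ι] {n : ℕ}

lemma tensorPow_mul {ι : Type*} [Fintype ι] (A B : Matrix ι ι ℂ) (n : ℕ) :
    tensorPow (A * B) n = tensorPow A n * tensorPow B n := by
  classical
  ext i j
  simp only [tensorPow, of_apply, Matrix.mul_apply]
  rw [Fintype.prod_sum]
  exact Finset.sum_congr rfl fun f _ => Finset.prod_mul_distrib

lemma conjTranspose_tensorPow {ι : Type*} (A : Matrix ι ι ℂ) (n : ℕ) :
    (tensorPow A n).conjTranspose = tensorPow A.conjTranspose n := by
  ext i j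
  simp [tensorPow]

lemma trace_tensorPow {ι : Type*} [Fintype ι] (A : Matrix ι ι ℂ) (n : ℕ) :
    (tensorPow A n).trace = A.trace ^ n := by
  classical
  have h := Fintype.prod_sum fun (_ : Fin n) (a : ι) => A a a
  rw [Finset.prod_const, Finset.card_univ, Fintype.card_fin] at h
  exact h.symm

-- Positivity follows from ρ = C* C, since then ρ^{⊗n} = (C^{⊗n})* C^{⊗n}.
open scoped MatrixOrder Matrix.Norms.L2Operator in
lemma tensorPow_mem_densityMatrices {ρ : Matrix ι ι ℂ} (hρ : ρ ∈ densityMatrices ι) (n : ℕ) :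
    tensorPow ρ n ∈ densityMatrices (Fin n → ι) := by
  refine ⟨?_, by rw [trace_tensorPow, hρ.2, one_pow]⟩
  obtain ⟨C, hC⟩ := CStarAlgebra.nonneg_iff_eq_star_mul_self.mp hρ.1.nonneg
  rw [hC, tensorPow_mul, star_eq_conjTranspose, ← conjTranspose_tensorPow]
  exact posSemidef_conjTranspose_mul_self _

lemma relEntropyOfResource_le {ρ : Matrix ι ι ℂ} (hρ : ρ ∈ densityMatrices ι)
    {S : Set (Matrix (Fin n → ι) (Fin n → ι) ℂ)} (hS : S ⊆ densityMatrices (Fin n → ι))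
    (hconv : Convex ℝ S) (hperm : ∀ σ ∈ S, ∀ π : Equiv.Perm (Fin n),
      permUnitary π * σ * (permUnitary π).conjTranspose ∈ S) :
    relEntropyOfResource S (tensorPow ρ n) ≤ measuredRelEntropyOfResource S (tensorPow ρ n) +
      (Real.log ((2 * (n + 1) ^ (Fintype.card ι ^ 2) : ℕ) : ℝ) : ℝ) := by
  have hρn := tensorPow_mem_densityMatrices hρ n
  -- The finite correction moves to the left so that the infimum can be bounded for each σ
  -- separately.
  rw [← EReal.sub_le_iff_le_add (Or.inl (EReal.coe_ne_bot _)) (Or.inl (EReal.coe_ne_top _))]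
  refine le_iInf₂ fun σ hσ => ?_
  rw [EReal.sub_le_iff_le_add (Or.inl (EReal.coe_ne_bot _)) (Or.inl (EReal.coe_ne_top _))]
  -- The members of S measured no worse than σ form a convex permutation-closed set containing σ, so
  -- it contains an invariant τ.
  obtain ⟨τ, ⟨hτS, -, hτle⟩, hτ⟩ := exists_mem_permInvariant
    (hconv.inter (convex_measuredRelEntropy_le hρn.1 (measuredRelEntropy (tensorPow ρ n) σ)))
    (fun τ hτ π => ⟨hperm τ hτ.1 π, (hS (hperm τ hτ.1 π)).1,
      (measuredRelEntropy_conj_le (conjTranspose_permUnitary_mul π)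
        (permUnitary_conj_tensorPow ρ π)).trans hτ.2.2⟩)
    ⟨σ, hσ, (hS hσ).1, le_rfl⟩
  refine (iInf₂_le τ hτS).trans ?_
  refine (relEntropy_le_measuredRelEntropy_add hρn (hS hτS) fun V s hV =>
    card_eigenvalues_le_of_mem_permInvariant hτ hV).trans ?_
  exact add_le_add_left hτle _

lemma measuredRelEntropyOfResource_le {κ : Type*} [Fintype κ] [DecidableEq κ]
    {ρ : Matrix κ κ ℂ} (hρ : ρ ∈ densityMatrices κ) {S : Set (Matrix κ κ ℂ)}
    (hS : S ⊆ densityMatrices κ) :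
    measuredRelEntropyOfResource S ρ ≤ relEntropyOfResource S ρ :=
  iInf₂_mono fun _ hσ => measuredRelEntropy_le_relEntropy hρ (hS hσ)

end Resource

end QRes


/-! ### Main theorem -/

theorem mainTheorem3 {ι : Type*} [Fintype ι] [DecidableEq ι]
    (M : (n : ℕ) → Set (Matrix (Fin n → ι) (Fin n → ι) ℂ))
    (hconv : QRes.ConvexClosedStates M) (hperm : QRes.PermutationClosed M)
    (ρ : Matrix ι ι ℂ) (hρ : ρ ∈ QRes.densityMatrices ι) :
    -- the minima are attained
    (∀ n, 1 ≤ n → (M n).Nonempty →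
      (∃ σ ∈ M n, QRes.measuredRelEntropy (QRes.tensorPow ρ n) σ
        = QRes.measuredRelEntropyOfResource (M n) (QRes.tensorPow ρ n)) ∧
      (∃ σ ∈ M n, QRes.relEntropy (QRes.tensorPow ρ n) σ
        = QRes.relEntropyOfResource (M n) (QRes.tensorPow ρ n))) ∧
    -- one limit exists if and only if the other does, and then they are equal
    (∀ L : EReal, QRes.HasRegularisedRelEntropy M ρ L ↔
      Tendsto (QRes.measuredRelEntropyRate M ρ) atTop (𝓝 L)) ∧
    -- whether or not the limits exist, the lower and the upper limits agree
    liminf (QRes.measuredRelEntropyRate M ρ) atTop = liminf (QRes.relEntropyRate M ρ) atTop ∧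
    limsup (QRes.measuredRelEntropyRate M ρ) atTop = limsup (QRes.relEntropyRate M ρ) atTop := by
  have hle : ∀ᶠ n in atTop,
      QRes.measuredRelEntropyRate M ρ n ≤ QRes.relEntropyRate M ρ n := by
    filter_upwards [eventually_ge_atTop 1] with n hn
    exact mul_le_mul_of_nonneg_left (QRes.measuredRelEntropyOfResource_le
      (QRes.tensorPow_mem_densityMatrices hρ n) (hconv.subset n hn))
      (EReal.coe_nonneg.2 (by positivity))
  have hge : ∀ᶠ n in atTop, QRes.relEntropyRate M ρ n ≤ QRes.measuredRelEntropyRate M ρ n +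
      ((1 / (n : ℝ) * Real.log ((2 * (n + 1) ^ (Fintype.card ι ^ 2) : ℕ) : ℝ) : ℝ) : EReal) := by
    filter_upwards [eventually_ge_atTop 1] with n hn
    have hpos : (0 : EReal) ≤ ((1 / (n : ℝ) : ℝ) : EReal) := EReal.coe_nonneg.2 (by positivity)
    have h := mul_le_mul_of_nonneg_left (QRes.relEntropyOfResource_le hρ (hconv.subset n hn)
      (hconv.convex n hn) (hperm n hn)) hpos
    rwa [EReal.left_distrib_of_nonneg_of_ne_top hpos (EReal.coe_ne_top _), ← EReal.coe_mul] at h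
  obtain ⟨hinf, hsup⟩ := QRes.liminf_eq_and_limsup_eq
    (QRes.tendsto_log_polynomial_div (Fintype.card ι ^ 2)) hle hge
  refine ⟨fun n hn hne => ?_, fun L => ?_, hinf, hsup⟩
  · have hcomp := QRes.isCompact_of_subset_densityMatrices (hconv.subset n hn) (hconv.closed n hn)
    have hρn := (QRes.tensorPow_mem_densityMatrices hρ n).1
    exact ⟨QRes.exists_eq_iInf hcomp hne ((QRes.lowerSemicontinuousOn_measuredRelEntropy hρn).mono
        fun σ hσ => (hconv.subset n hn hσ).1),
      QRes.exists_eq_iInf hcomp hne ((QRes.lowerSemicontinuousOn_relEntropy hρn).mono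
        (hconv.subset n hn))⟩
  · exact QRes.tendsto_iff_of_liminf_eq_of_limsup_eq hinf.symm hsup.symm L
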